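/- Let $d\ge 1$, let $\omega\colon\mathbb R^d\to[0,\infty)$ be a non-constant, bounded, continuous function, and put $\omega_0:=\inf_{k}\omega(k)$, $\omega_1:=\sup_{k}\omega(k)$. Let $\lambda\in L^2(\mathbb R^d)$, $\lambda\neq 0$, let $\gamma\in\mathbb R$, and let $\alpha>0$ be arbitrary. Let $L^2_s(\mathbb R^d\times\mathbb R^d)$ be the subspace of symmetric functions in $L^2(\mathbb R^d\times\mathbb R^d)$, equipped with one half of the inner product of the latter, and let $$\mathcal A=\begin{pmatrix}A&B\\ C&D\end{pmatrix}\quad\text{in}\quad L^2(\mathbb R^d)\oplus L^2_s(\mathbb R^d\times\mathbb R^d)$$ be the bounded self-adjoint operator with entries $$(Af)(k)=(-\gamma+\omega(k))f(k),\qquad (Bg)(k)=\alpha\int_{\mathbb R^d} g(k,q)\lambda(q)\,dq,$$ $$(Cf)(k,q)=\alpha\overline{\lambda(k)}f(q)+\alpha\overline{\lambda(q)}f(k),\qquad (Dg)(k,q)=(\gamma+\omega(k)+\omega(q))g(k,q).$$ For $z\in(-\infty,\omega_0+\gamma)\cup(\omega_1+\gamma,\infty)$ let $$\Phi(z)=-\gamma-z-\alpha^2\int_{\mathbb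 R^d}\frac{|\lambda(q)|^2\,dq}{\omega(q)+\gamma-z}.$$ Denote by $E$ the zero of $\Phi$ in $(-\infty,\omega_0+\gamma)$ and by $F$ the zero of $\Phi$ in $(\omega_1+\gamma,\infty)$; each is unique whenever it exists. The discrete spectrum of $\mathcal A$ is the set of isolated points of its spectrum that are eigenvalues of finite multiplicity. Then: 1. if $E$ exists, neither $\omega_0+E$ nor $\omega_1+E$ is an accumulation point of the discrete spectrum of $\mathcal A$; 2. if $F$ exists, neither $\omega_0+F$ nor $\omega_1+F$ is an accumulation point of the discrete spectrum of $\mathcal A$. -/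

import Mathlib

open MeasureTheory Set Filter Topology
open scoped ENNReal BoundedContinuousFunction

noncomputable section

namespace SpinBoson

/-- The one-boson configuration space `ℝ^d` with its Euclidean structure and Lebesgue measure. -/
abbrev X (d : ℕ) : Type := EuclideanSpace ℝ (Fin d)

/-- Half of Lebesgue measure on `ℝ^d × ℝ^d`. The inner product of `L²` with respect to this measure
is one half of the usual inner product of `L²(ℝ^d × ℝ^d)`. -/
def halfVol (d : ℕ) : Measure (X d × X d) := (2⁻¹ : ℝ≥0∞) • (volume : Measure (X d × X d))

/-- `L²(ℝ^d)`. -/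
abbrev L2 (d : ℕ) : Type := Lp ℂ 2 (volume : Measure (X d))

/-- `L²(ℝ^d × ℝ^d)` with the `1/2`-inner product. -/
abbrev L2half (d : ℕ) : Type := Lp ℂ 2 (halfVol d)

lemma halfVol_ac (d : ℕ) : halfVol d ≪ (volume : Measure (X d × X d)) :=
  Measure.smul_absolutelyContinuous

lemma ac_halfVol (d : ℕ) : (volume : Measure (X d × X d)) ≪ halfVol d :=
  Measure.absolutelyContinuous_smul (by simp)

lemma qmp_swap (d : ℕ) :
    Measure.QuasiMeasurePreserving (Prod.swap : X d × X d → X d × X d)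
      (halfVol d) (halfVol d) :=
  ((Measure.measurePreserving_swap (μ := (volume : Measure (X d)))
    (ν := (volume : Measure (X d)))).quasiMeasurePreserving).mono
    (halfVol_ac d) (ac_halfVol d)

lemma qmp_fst (d : ℕ) :
    Measure.QuasiMeasurePreserving (Prod.fst : X d × X d → X d) (halfVol d) volume :=
  (Measure.quasiMeasurePreserving_fst (μ := (volume : Measure (X d)))
    (ν := (volume : Measure (X d)))).mono_left (halfVol_ac d)

lemma qmp_snd (d : ℕ) :
    Measure.QuasiMeasurePreserving (Prod.snd : X d × X d → X d) (halfVol d) volume :=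
  (Measure.quasiMeasurePreserving_snd (μ := (volume : Measure (X d)))
    (ν := (volume : Measure (X d)))).mono_left (halfVol_ac d)

/-- `L²_s(ℝ^d × ℝ^d)`: the subspace of symmetric functions, with the `1/2`-inner product. -/
def L2sym (d : ℕ) : Submodule ℂ (L2half d) where
  carrier := {g | ∀ᵐ p ∂(halfVol d), g p.swap = g p}
  zero_mem' := by
    have h := Lp.coeFn_zero ℂ 2 (halfVol d)
    have h' := (qmp_swap d).ae h
    simp only [mem_ofPred_eq]
    filter_upwards [h, h'] with p hp hp'
    rw [hp, hp']; rfl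
  add_mem' := by
    intro f g hf hg
    have h := Lp.coeFn_add f g
    have h' := (qmp_swap d).ae h
    simp only [mem_ofPred_eq] at hf hg ⊢
    filter_upwards [h, h', hf, hg] with p hp hp' h1 h2
    rw [hp, hp', Pi.add_apply, Pi.add_apply, h1, h2]
  smul_mem' := by
    intro c f hf
    have h := Lp.coeFn_smul c f
    have h' := (qmp_swap d).ae h
    simp only [mem_ofPred_eq] at hf ⊢
    filter_upwards [h, h', hf] with p hp hp' h1
    rw [hp, hp', Pi.smul_apply, Pi.smul_apply, h1]

/-- The Hilbert space `L²(ℝ^d) ⊕ L²_s(ℝ^d × ℝ^d)` (orthogonal sum). -/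
abbrev H (d : ℕ) : Type := WithLp 2 (L2 d × L2sym d)

section Multiplication

lemma norm_mul_le {Y : Type*} [TopologicalSpace Y] (m : Y →ᵇ ℝ) (f : Y → ℂ) (x : Y) :
    ‖(m x : ℂ) * f x‖ ≤ ‖m‖ * ‖f x‖ := by
  rw [norm_mul, Complex.norm_real]
  exact mul_le_mul_of_nonneg_right (m.norm_coe_le_norm x) (norm_nonneg _)

variable {Y : Type*} [TopologicalSpace Y] [MeasurableSpace Y] [OpensMeasurableSpace Y]
  {μ : Measure Y}

lemma memLp_mul (m : Y →ᵇ ℝ) (f : Lp ℂ 2 μ) : MemLp (fun x => (m x : ℂ) * f x) 2 μ :=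
  MemLp.of_le_mul (Lp.memLp f)
    ((Complex.continuous_ofReal.comp m.continuous).aestronglyMeasurable.mul
      (Lp.aestronglyMeasurable f))
    (ae_of_all _ (norm_mul_le m f))

/-- Multiplication by the bounded continuous function `m`, as an operator in `L²(μ)`. -/
def mulOp (μ : Measure Y) (m : Y →ᵇ ℝ) : Lp ℂ 2 μ →L[ℂ] Lp ℂ 2 μ :=
  LinearMap.mkContinuousOfExistsBound
    { toFun := fun f => (memLp_mul m f).toLp (fun x => (m x : ℂ) * f x)
      map_add' := by
        intro f g
        rw [← MemLp.toLp_add]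
        apply MemLp.toLp_congr
        filter_upwards [Lp.coeFn_add f g] with x hx
        simp only [hx, Pi.add_apply, mul_add]
      map_smul' := by
        intro c f
        rw [RingHom.id_apply, ← MemLp.toLp_const_smul]
        apply MemLp.toLp_congr
        filter_upwards [Lp.coeFn_smul c f] with x hx
        simp only [hx, Pi.smul_apply, smul_eq_mul]
        ring }
    ⟨‖m‖, fun f => Lp.norm_le_mul_norm_of_ae_le_mul (by
      filter_upwards [(memLp_mul m f).coeFn_toLp] with x hx
      simp only [LinearMap.coe_mk, AddHom.coe_mk, hx]
      exact norm_mul_le m f x)⟩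

lemma mulOp_ae (m : Y →ᵇ ℝ) (f : Lp ℂ 2 μ) :
    ∀ᵐ x ∂μ, mulOp μ m f x = (m x : ℂ) * f x :=
  (memLp_mul m f).coeFn_toLp

end Multiplication

section Entries

variable {d : ℕ}

/-- The entry `A`: `(A f)(k) = (-γ + ω(k)) f(k)`. -/
def opA (ω : X d →ᵇ ℝ) (γ : ℝ) : L2 d →L[ℂ] L2 d :=
  mulOp volume (BoundedContinuousFunction.const (X d) (-γ) + ω)

/-- The function `(k, q) ↦ γ + ω(k) + ω(q)`. -/
def symbolD (ω : X d →ᵇ ℝ) (γ : ℝ) : X d × X d →ᵇ ℝ :=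
  BoundedContinuousFunction.const (X d × X d) γ
    + ω.compContinuous ⟨Prod.fst, continuous_fst⟩
    + ω.compContinuous ⟨Prod.snd, continuous_snd⟩

lemma symbolD_apply (ω : X d →ᵇ ℝ) (γ : ℝ) (p : X d × X d) :
    symbolD ω γ p = γ + ω p.1 + ω p.2 := rfl

lemma mulOp_symbolD_mem (ω : X d →ᵇ ℝ) (γ : ℝ) (g : L2sym d) :
    mulOp (halfVol d) (symbolD ω γ) (g : L2half d) ∈ L2sym d := by
  have h := mulOp_ae (μ := halfVol d) (symbolD ω γ) (g : L2half d)
  have h' := (qmp_swap d).ae h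
  have hg : ∀ᵐ p ∂(halfVol d), (g : L2half d) p.swap = (g : L2half d) p := g.2
  change ∀ᵐ p ∂(halfVol d), _ = _
  filter_upwards [h, h', hg] with p h1 h2 h3
  rw [h1, h2, h3, symbolD_apply, symbolD_apply, Prod.fst_swap, Prod.snd_swap, add_right_comm]

/-- The entry `D`: `(D g)(k, q) = (γ + ω(k) + ω(q)) g(k, q)`. -/
def opD (ω : X d →ᵇ ℝ) (γ : ℝ) : L2sym d →L[ℂ] L2sym d :=
  (mulOp (halfVol d) (symbolD ω γ) ∘L (L2sym d).subtypeL).codRestrict (L2sym d)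
    (mulOp_symbolD_mem ω γ)

/-! ### The entry `B` -/

lemma memLp_volume (g : L2half d) : MemLp g 2 (volume : Measure (X d × X d)) := by
  refine (Lp.memLp g).of_measure_le_smul (c := 2) (by simp) ?_
  rw [halfVol, smul_smul, ENNReal.mul_inv_cancel (by simp) (by simp), one_smul]

lemma lintegral_sq_lt_top {Y : Type*} [MeasurableSpace Y] {μ : Measure Y} {f : Y → ℂ}
    (hf : MemLp f 2 μ) : ∫⁻ y, ‖f y‖ₑ ^ (2 : ℝ) ∂μ < ∞ := by
  have := lintegral_rpow_enorm_lt_top_of_eLpNorm_lt_top (p := 2) (by simp) (by simp) hf.2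
  simpa using this

lemma ae_memLp_slice (g : L2half d) :
    ∀ᵐ k : X d, MemLp (fun q : X d => g (k, q)) 2 volume := by
  have hg := memLp_volume g
  have h1 : ∀ᵐ k : X d, AEStronglyMeasurable (fun q : X d => g (k, q)) volume :=
    hg.1.prodMk_left
  have hm : AEMeasurable (fun p : X d × X d => ‖g p‖ₑ ^ (2 : ℝ))
      ((volume : Measure (X d)).prod volume) := (hg.1.enorm).pow_const _
  have h2 : ∀ᵐ k : X d, ∫⁻ q : X d, ‖g (k, q)‖ₑ ^ (2 : ℝ) < ∞ := by
    refine ae_lt_top' hm.lintegral_prod_right' ?_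
    rw [← lintegral_prod _ hm]
    exact (lintegral_sq_lt_top hg).ne
  filter_upwards [h1, h2] with k hk1 hk2
  refine ⟨hk1, ?_⟩
  rw [eLpNorm_lt_top_iff_lintegral_rpow_enorm_lt_top (by simp) (by simp)]
  simpa using hk2

lemma ae_integrable_slice (lam : L2 d) (g : L2half d) :
    ∀ᵐ k : X d, Integrable (fun q : X d => g (k, q) * lam q) volume := by
  filter_upwards [ae_memLp_slice g] with k hk
  exact hk.integrable_mul (Lp.memLp lam)

/-- The function `k ↦ α ∫ g(k, q) λ(q) dq`. -/
def funB (lam : L2 d) (α : ℝ) (g : L2half d) (k : X d) : ℂ :=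
  (α : ℂ) * ∫ q : X d, g (k, q) * lam q

lemma aesm_funB (lam : L2 d) (α : ℝ) (g : L2half d) :
    AEStronglyMeasurable (funB lam α g) volume := by
  have h : AEStronglyMeasurable (fun p : X d × X d => g p * lam p.2)
      ((volume : Measure (X d)).prod volume) :=
    (memLp_volume g).1.mul ((Lp.aestronglyMeasurable lam).comp_snd)
  exact h.integral_prod_right'.const_mul _

lemma eLpNorm_two {Y : Type*} [MeasurableSpace Y] {μ : Measure Y} (f : Y → ℂ) :
    eLpNorm f 2 μ = (∫⁻ y, ‖f y‖ₑ ^ (2 : ℝ) ∂μ) ^ (1 / 2 : ℝ) := by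
  rw [eLpNorm_eq_lintegral_rpow_enorm_toReal (by simp) (by simp), ENNReal.toReal_ofNat]

lemma eLpNorm_funB_le (lam : L2 d) (α : ℝ) (g : L2half d) :
    eLpNorm (funB lam α g) 2 volume ≤ ENNReal.ofReal (|α| * 2 * ‖lam‖ * ‖g‖) := by
  have hg := memLp_volume g
  have hm : AEMeasurable (fun p : X d × X d => ‖g p‖ₑ ^ (2 : ℝ))
      ((volume : Measure (X d)).prod volume) := (hg.1.enorm).pow_const _
  obtain ⟨c, hc⟩ : ∃ c : ℝ≥0∞, c = 2 := ⟨2, rfl⟩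
  have hc2 : c ≤ c ^ (2 : ℝ) := by
    rw [hc]; norm_num
  have hgn : ∫⁻ p, ‖g p‖ₑ ^ (2 : ℝ) ∂(volume : Measure (X d × X d))
      = c * ∫⁻ p, ‖g p‖ₑ ^ (2 : ℝ) ∂(halfVol d) := by
    unfold halfVol
    rw [hc, lintegral_smul_measure, smul_eq_mul, ← mul_assoc,
      ENNReal.mul_inv_cancel (by simp) (by simp), one_mul]
  have hpt : ∀ᵐ k : X d, ‖funB lam α g k‖ₑ ^ (2 : ℝ) ≤ ENNReal.ofReal |α| ^ (2 : ℝ) *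
      ((∫⁻ q : X d, ‖lam q‖ₑ ^ (2 : ℝ)) * ∫⁻ q : X d, ‖g (k, q)‖ₑ ^ (2 : ℝ)) := by
    filter_upwards [ae_memLp_slice g] with k hk
    have hα : ‖(α : ℂ)‖ₑ = ENNReal.ofReal |α| := by
      rw [← ofReal_norm, Complex.norm_real, Real.norm_eq_abs]
    have h1 : ‖∫ q : X d, g (k, q) * lam q‖ₑ ≤
        (∫⁻ q : X d, ‖g (k, q)‖ₑ ^ (2 : ℝ)) ^ (1 / 2 : ℝ) *
          (∫⁻ q : X d, ‖lam q‖ₑ ^ (2 : ℝ)) ^ (1 / 2 : ℝ) := by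
      refine (enorm_integral_le_lintegral_enorm _).trans ?_
      simp only [enorm_mul]
      exact ENNReal.lintegral_mul_le_Lp_mul_Lq volume Real.HolderConjugate.two_two
        hk.1.enorm (Lp.aestronglyMeasurable lam).enorm
    rw [funB, enorm_mul, hα, ENNReal.mul_rpow_of_nonneg _ _ (by norm_num)]
    gcongr
    refine (ENNReal.rpow_le_rpow h1 (by norm_num)).trans ?_
    rw [ENNReal.mul_rpow_of_nonneg _ _ (by norm_num), ← ENNReal.rpow_mul, ← ENNReal.rpow_mul]
    norm_num
    rw [mul_comm]
  have key : eLpNorm (funB lam α g) 2 volume ≤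
      ENNReal.ofReal |α| * (eLpNorm lam 2 volume * (c * eLpNorm g 2 (halfVol d))) := by
    simp only [eLpNorm_two]
    have h0 : ∀ x : ℝ≥0∞, x = (x ^ (2 : ℝ)) ^ (1 / 2 : ℝ) := fun x => by
      rw [← ENNReal.rpow_mul]; norm_num
    rw [h0 (ENNReal.ofReal |α|), h0 c,
      ← ENNReal.mul_rpow_of_nonneg _ _ (by norm_num),
      ← ENNReal.mul_rpow_of_nonneg _ _ (by norm_num),
      ← ENNReal.mul_rpow_of_nonneg _ _ (by norm_num)]
    refine ENNReal.rpow_le_rpow ?_ (by norm_num)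
    refine (lintegral_mono_ae hpt).trans ?_
    rw [lintegral_const_mul'' _ (hm.lintegral_prod_right'.const_mul _),
      lintegral_const_mul'' _ hm.lintegral_prod_right', ← lintegral_prod _ hm,
      ← Measure.volume_eq_prod, hgn]
    gcongr
  refine key.trans (le_of_eq ?_)
  rw [Lp.norm_def, Lp.norm_def, ENNReal.ofReal_mul (by positivity),
    ENNReal.ofReal_mul (by positivity), ENNReal.ofReal_mul (by positivity),
    ENNReal.ofReal_toReal (Lp.memLp lam).2.ne, ENNReal.ofReal_toReal (Lp.memLp g).2.ne,
    ENNReal.ofReal_ofNat, hc]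
  ring

lemma memLp_funB (lam : L2 d) (α : ℝ) (g : L2half d) : MemLp (funB lam α g) 2 volume :=
  ⟨aesm_funB lam α g, (eLpNorm_funB_le lam α g).trans_lt ENNReal.ofReal_lt_top⟩

lemma ae_slice (P : X d × X d → Prop) (h : ∀ᵐ p ∂(halfVol d), P p) :
    ∀ᵐ k : X d, ∀ᵐ q : X d, P (k, q) :=
  Measure.ae_ae_of_ae_prod ((ac_halfVol d).ae_le h)

/-- The formula of the entry `B` on all of `L²(ℝ^d × ℝ^d)`. -/
def opBfull (lam : L2 d) (α : ℝ) : L2half d →L[ℂ] L2 d :=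
  LinearMap.mkContinuousOfExistsBound
    { toFun := fun g => (memLp_funB lam α g).toLp (funB lam α g)
      map_add' := by
        intro f g
        rw [← MemLp.toLp_add]
        apply MemLp.toLp_congr
        filter_upwards [ae_slice _ (Lp.coeFn_add f g), ae_integrable_slice lam f,
          ae_integrable_slice lam g] with k hk h1 h2
        simp only [funB, Pi.add_apply]
        rw [← mul_add, ← integral_add h1 h2]
        congr 1
        refine integral_congr_ae ?_
        filter_upwards [hk] with q hq
        rw [hq, Pi.add_apply, add_mul]
      map_smul' := by
        intro c g
        rw [RingHom.id_apply, ← MemLp.toLp_const_smul]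
        apply MemLp.toLp_congr
        filter_upwards [ae_slice _ (Lp.coeFn_smul c g)] with k hk
        simp only [funB, Pi.smul_apply, smul_eq_mul]
        have e : ∫ q : X d, (c • g : L2half d) (k, q) * lam q = c * ∫ q : X d, g (k, q) * lam q := by
          rw [← integral_const_mul]
          refine integral_congr_ae ?_
          filter_upwards [hk] with q hq
          rw [hq, Pi.smul_apply, smul_eq_mul, mul_assoc]
        rw [e, mul_left_comm] }
    ⟨|α| * 2 * ‖lam‖, fun g => by
      change ‖(memLp_funB lam α g).toLp (funB lam α g)‖ ≤ _
      rw [Lp.norm_toLp]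
      exact ENNReal.toReal_le_of_le_ofReal (by positivity) (eLpNorm_funB_le lam α g)⟩

/-- The entry `B`: `(B g)(k) = α ∫ g(k, q) λ(q) dq`. -/
def opB (lam : L2 d) (α : ℝ) : L2sym d →L[ℂ] L2 d :=
  opBfull lam α ∘L (L2sym d).subtypeL

/-! ### The entry `C` -/

/-- The function `(k, q) ↦ α λ̄(k) f(q) + α λ̄(q) f(k)`. -/
def funC (lam : L2 d) (α : ℝ) (f : L2 d) (p : X d × X d) : ℂ :=
  (α : ℂ) * starRingEnd ℂ (lam p.1) * f p.2 + (α : ℂ) * starRingEnd ℂ (lam p.2) * f p.1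

lemma aesm_tensor (a b : L2 d) : AEStronglyMeasurable
    (fun p : X d × X d => starRingEnd ℂ (a p.1) * b p.2) (halfVol d) := by
  have h1 := (Complex.continuous_conj.comp_aestronglyMeasurable
    (Lp.aestronglyMeasurable a)).comp_quasiMeasurePreserving (qmp_fst d)
  have h2 := (Lp.aestronglyMeasurable b).comp_quasiMeasurePreserving (qmp_snd d)
  exact h1.mul h2

lemma eLpNorm_tensor_le (a b : L2 d) :
    eLpNorm (fun p : X d × X d => starRingEnd ℂ (a p.1) * b p.2) 2 (halfVol d)
      ≤ ENNReal.ofReal (‖a‖ * ‖b‖) := by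
  have ha := (Lp.aestronglyMeasurable a).enorm.pow_const (2 : ℝ)
  have hb := (Lp.aestronglyMeasurable b).enorm.pow_const (2 : ℝ)
  rw [ENNReal.ofReal_mul (by positivity), Lp.norm_def, Lp.norm_def,
    ENNReal.ofReal_toReal (Lp.memLp a).2.ne, ENNReal.ofReal_toReal (Lp.memLp b).2.ne]
  simp only [eLpNorm_two]
  rw [← ENNReal.mul_rpow_of_nonneg _ _ (by norm_num), ← lintegral_prod_mul ha hb,
    halfVol, lintegral_smul_measure, Measure.volume_eq_prod]
  refine ENNReal.rpow_le_rpow ?_ (by norm_num)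
  calc _ ≤ 1 * ∫⁻ p : X d × X d, ‖starRingEnd ℂ (a p.1) * b p.2‖ₑ ^ (2 : ℝ)
        ∂((volume : Measure (X d)).prod volume) := by
        rw [smul_eq_mul]
        gcongr
        exact ENNReal.inv_le_one.2 (by norm_num)
    _ = _ := by
        rw [one_mul]
        refine lintegral_congr fun p => ?_
        rw [enorm_mul, ENNReal.mul_rpow_of_nonneg _ _ (by norm_num), RCLike.enorm_conj]

lemma aesm_tensor_swap (a b : L2 d) : AEStronglyMeasurable
    (fun p : X d × X d => starRingEnd ℂ (a p.2) * b p.1) (halfVol d) :=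
  (aesm_tensor a b).comp_quasiMeasurePreserving (qmp_swap d)

lemma eLpNorm_tensor_swap (a b : L2 d) :
    eLpNorm (fun p : X d × X d => starRingEnd ℂ (a p.2) * b p.1) 2 (halfVol d)
      = eLpNorm (fun p : X d × X d => starRingEnd ℂ (a p.1) * b p.2) 2 (halfVol d) := by
  have h : MeasurePreserving (Prod.swap : X d × X d → X d × X d) (halfVol d) (halfVol d) :=
    MeasurePreserving.smul_measure (Measure.measurePreserving_swap
      (μ := (volume : Measure (X d))) (ν := (volume : Measure (X d)))) (2⁻¹ : ℝ≥0∞)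
  have h2 := eLpNorm_comp_measurePreserving (p := 2) (aesm_tensor a b) h
  rw [← h2]
  rfl

lemma funC_eq (lam : L2 d) (α : ℝ) (f : L2 d) :
    funC lam α f = ((α : ℂ) • fun p : X d × X d => starRingEnd ℂ (lam p.1) * f p.2)
      + ((α : ℂ) • fun p : X d × X d => starRingEnd ℂ (lam p.2) * f p.1) := by
  funext p
  simp only [funC, Pi.add_apply, Pi.smul_apply, smul_eq_mul, mul_assoc]

lemma eLpNorm_funC_le (lam : L2 d) (α : ℝ) (f : L2 d) :
    eLpNorm (funC lam α f) 2 (halfVol d) ≤ ENNReal.ofReal (2 * |α| * ‖lam‖ * ‖f‖) := by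
  rw [funC_eq]
  refine (eLpNorm_add_le ((aesm_tensor lam f).const_smul _)
    ((aesm_tensor_swap lam f).const_smul _) (by norm_num)).trans ?_
  rw [eLpNorm_const_smul, eLpNorm_const_smul, eLpNorm_tensor_swap]
  have hα : ‖(α : ℂ)‖ₑ = ENNReal.ofReal |α| := by
    rw [← ofReal_norm, Complex.norm_real, Real.norm_eq_abs]
  rw [hα, ← two_mul]
  have e : ENNReal.ofReal (2 * |α| * ‖lam‖ * ‖f‖)
      = 2 * (ENNReal.ofReal |α| * ENNReal.ofReal (‖lam‖ * ‖f‖)) := by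
    rw [← ENNReal.ofReal_mul (by positivity), mul_assoc, mul_assoc,
      ENNReal.ofReal_mul (by positivity), ENNReal.ofReal_ofNat]
  rw [e]
  gcongr
  exact eLpNorm_tensor_le lam f

lemma aesm_funC (lam : L2 d) (α : ℝ) (f : L2 d) :
    AEStronglyMeasurable (funC lam α f) (halfVol d) := by
  rw [funC_eq]
  exact ((aesm_tensor lam f).const_smul _).add ((aesm_tensor_swap lam f).const_smul _)

lemma memLp_funC (lam : L2 d) (α : ℝ) (f : L2 d) : MemLp (funC lam α f) 2 (halfVol d) :=
  ⟨aesm_funC lam α f, (eLpNorm_funC_le lam α f).trans_lt ENNReal.ofReal_lt_top⟩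

/-- The formula of the entry `C`, with values in all of `L²(ℝ^d × ℝ^d)`. -/
def opCfull (lam : L2 d) (α : ℝ) : L2 d →L[ℂ] L2half d :=
  LinearMap.mkContinuousOfExistsBound
    { toFun := fun f => (memLp_funC lam α f).toLp (funC lam α f)
      map_add' := by
        intro f g
        rw [← MemLp.toLp_add]
        apply MemLp.toLp_congr
        filter_upwards [(qmp_fst d).ae (Lp.coeFn_add f g), (qmp_snd d).ae (Lp.coeFn_add f g)]
          with p h1 h2
        simp only [funC, Pi.add_apply, h1, h2]
        ring
      map_smul' := by
        intro c f
        rw [RingHom.id_apply, ← MemLp.toLp_const_smul]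
        apply MemLp.toLp_congr
        filter_upwards [(qmp_fst d).ae (Lp.coeFn_smul c f), (qmp_snd d).ae (Lp.coeFn_smul c f)]
          with p h1 h2
        simp only [funC, Pi.smul_apply, h1, h2, smul_eq_mul]
        ring }
    ⟨2 * |α| * ‖lam‖, fun f => by
      change ‖(memLp_funC lam α f).toLp (funC lam α f)‖ ≤ _
      rw [Lp.norm_toLp]
      exact ENNReal.toReal_le_of_le_ofReal (by positivity) (eLpNorm_funC_le lam α f)⟩

lemma opCfull_mem (lam : L2 d) (α : ℝ) (f : L2 d) : opCfull lam α f ∈ L2sym d := by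
  have h : ∀ᵐ p ∂(halfVol d), opCfull lam α f p = funC lam α f p :=
    (memLp_funC lam α f).coeFn_toLp
  have h' := (qmp_swap d).ae h
  change ∀ᵐ p ∂(halfVol d), _ = _
  filter_upwards [h, h'] with p h1 h2
  rw [h1, h2, funC, funC, Prod.fst_swap, Prod.snd_swap, add_comm]

/-- The entry `C`: `(C f)(k, q) = α λ̄(k) f(q) + α λ̄(q) f(k)`. -/
def opC (lam : L2 d) (α : ℝ) : L2 d →L[ℂ] L2sym d :=
  (opCfull lam α).codRestrict (L2sym d) (opCfull_mem lam α)

/-- The operator matrix `𝒜 = (A B; C D)` in `L²(ℝ^d) ⊕ L²_s(ℝ^d × ℝ^d)`. -/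
def opMatrix (ω : X d →ᵇ ℝ) (lam : L2 d) (γ α : ℝ) : H d →L[ℂ] H d :=
  (WithLp.prodContinuousLinearEquiv 2 ℂ (L2 d) (L2sym d)).symm.toContinuousLinearMap ∘L
    (((opA ω γ).coprod (opB lam α)).prod ((opC lam α).coprod (opD ω γ))) ∘L
      (WithLp.prodContinuousLinearEquiv 2 ℂ (L2 d) (L2sym d)).toContinuousLinearMap

/-- `ω₀`, the infimum of the dispersion relation. -/
def omegaInf (ω : X d →ᵇ ℝ) : ℝ := ⨅ k, ω k

/-- `ω₁`, the supremum of the dispersion relation. -/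
def omegaSup (ω : X d →ᵇ ℝ) : ℝ := ⨆ k, ω k

/-- The function `Φ(z) = -γ - z - α² ∫ |λ(q)|² / (ω(q) + γ - z) dq`, to be used for
`z ∈ (-∞, ω₀ + γ) ∪ (ω₁ + γ, ∞)`, where the integrand is integrable. -/
def Phi (ω : X d →ᵇ ℝ) (lam : L2 d) (γ α z : ℝ) : ℝ :=
  -γ - z - α ^ 2 * ∫ q : X d, ‖lam q‖ ^ 2 / (ω q + γ - z)

end Entries

/-- The discrete spectrum of a bounded self-adjoint operator: the isolated points of the spectrum
that are eigenvalues of finite multiplicity. -/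
def discreteSpectrum {V : Type*} [NormedAddCommGroup V] [NormedSpace ℂ V] (T : V →L[ℂ] V) :
    Set ℂ :=
  {z | z ∈ spectrum ℂ T ∧ ¬ AccPt z (𝓟 (spectrum ℂ T)) ∧
    Module.End.HasEigenvalue (T : Module.End ℂ V) z ∧
    FiniteDimensional ℂ (Module.End.eigenspace (T : Module.End ℂ V) z)}

end SpinBoson

end

/-!
Why the edges of the two-particle branches do not attract discrete eigenvalues.

Let `σ = ±1` and let `z` lie below (`σ = 1`) or above (`σ = -1`) the interval
`[2ω₀ + γ, 2ω₁ + γ]`, so that `σ (D - z)` is multiplication by `a k + a q` with `a` positive and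
bounded below. Completing the square in the two-boson component (`form_identity`) writes the form
of `σ (𝒜 - z)` at `(f, g)` as
`∫ σ Φ(z - ω k) |f k|² - α² Re ∬ conj (u k) u q / (a k + a q)`, with `u = λ f`, plus a nonnegative
square that vanishes for eigenvectors. Everything rests on the Cauchy kernel `1 / (a + b)`. With
`p = (a - c) / (a + c)` and `p'` the same expression in `b`,
`1 / (a + b) = 2c / ((a + c) (b + c)) + p p' / (a + b)`,
and iterating this (`cauchyForm_eq_sum`) displays the Cauchy form as a sum of rank-one squares and a
remainder that carries the factors `p ^ N` and `p' ^ N`. Two consequences are used.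

* The Cauchy form is nonnegative (`cauchyForm_nonneg`). Between `ω₁ + E` and `2ω₀ + γ`, and between
  `2ω₁ + γ` and `ω₀ + F`, the function `σ Φ(z - ω)` is negative and bounded away from `0`, so there
  are no eigenvalues there (`not_hasEigenvalue_gap`).
* For `c = min a` the factor `p` vanishes where `a` is minimal, so after `N` rank-one terms are
  removed the form is at most a small multiple of `∫ (a - c) |f|²`
  (`cauchyForm_le_of_vanishing`). At `z = ω₀ + E` and `z = ω₁ + F` one has `σ Φ(z - ω) ≥ a - c`,
  because `Φ` decreases at least as fast as `-id`. Hence the form of `σ (𝒜 - z)` is nonnegative on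
  a subspace of finite codimension, and only finitely many eigenvalues lie beyond these edges
  (`finite_eigenvalues_beyond`). No regularity of `ω` or decay of `λ` near the extrema enters.

On the remaining sides of the edges lie the intervals `[ω₀ + x, ω₁ + x]` with `x = E` or `x = F`, or
`[2ω₀ + γ, 2ω₁ + γ]`. Explicit approximate eigenvectors show that their interior points belong to
the spectrum (`two_particle_mem_spectrum`, `three_particle_mem_spectrum`), so none of these points
is isolated in it.
-/

namespace SpinBoson

/-! ### The Cauchy form -/

/-- The Cayley transform `(a - c) / (a + c)`. -/
noncomputable def cayley {Y : Type*} (c : ℝ) (a : Y → ℝ) (y : Y) : ℝ := (a y - c) / (a y + c)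

lemma abs_cayley_le_one {Y : Type*} {a : Y → ℝ} {m c : ℝ} (hm : 0 < m) (hc : 0 < c)
    (ham : ∀ y, m ≤ a y) (y : Y) :
    |cayley c a y| ≤ 1 := by
  have h := ham y
  rw [cayley, abs_div, abs_of_pos (show 0 < a y + c by linarith), div_le_one (by linarith), abs_le]
  constructor <;> linarith

section CauchyForm

variable {Y : Type*} [MeasurableSpace Y] {μ : Measure Y} {a : Y → ℝ} {u : Y → ℂ} {m c : ℝ}

/-- The quadratic form `Re ∬ conj (u x) u y / (a x + a y)` of the Cauchy kernel built from `a`. -/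
noncomputable def cauchyForm (μ : Measure Y) (a : Y → ℝ) (u : Y → ℂ) : ℝ :=
  (∫ p, starRingEnd ℂ (u p.1) * u p.2 / ((a p.1 + a p.2 : ℝ) : ℂ) ∂(μ.prod μ)).re

lemma measurable_cayley (ha : Measurable a) : Measurable (cayley c a) :=
  (ha.sub_const c).div (ha.add_const c)

lemma integrable_conj (hu : Integrable u μ) : Integrable (fun y => starRingEnd ℂ (u y)) μ :=
  (LinearIsometryEquiv.integrable_comp_iff Complex.conjLIE).2 hu

lemma integrable_ofReal_mul {b : Y → ℝ} (hb : Measurable b) {C : ℝ} (hbC : ∀ y, |b y| ≤ C)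
    (hu : Integrable u μ) : Integrable (fun y => u y * (b y : ℂ)) μ :=
  hu.mul_bdd (c := C) (Complex.measurable_ofReal.comp hb).aestronglyMeasurable
    (ae_of_all _ fun y => by simpa [Complex.norm_real] using hbC y)

lemma integrable_mul_cayley_pow (hu : Integrable u μ) (ha : Measurable a) (hm : 0 < m)
    (ham : ∀ y, m ≤ a y) (hc : 0 < c) (n : ℕ) :
    Integrable (fun y => u y * ((cayley c a y ^ n : ℝ) : ℂ)) μ :=
  integrable_ofReal_mul ((measurable_cayley ha).pow_const n) (C := 1) (fun y => by
    rw [abs_pow]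
    exact pow_le_one₀ (abs_nonneg _) (abs_cayley_le_one hm hc ham y)) hu

lemma integrable_cauchy (hu : Integrable u μ) (ha : Measurable a) (hm : 0 < m)
    (ham : ∀ y, m ≤ a y) :
    Integrable (fun p : Y × Y => starRingEnd ℂ (u p.1) * u p.2 / ((a p.1 + a p.2 : ℝ) : ℂ))
      (μ.prod μ) := by
  have h := (integrable_conj hu).mul_prod hu
  simp only [div_eq_mul_inv]
  refine h.mul_bdd (c := (2 * m)⁻¹) ?_ (ae_of_all _ fun p => ?_)
  · exact (Complex.measurable_ofReal.comp
      ((ha.comp measurable_fst).add (ha.comp measurable_snd))).inv.aestronglyMeasurable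
  · have h1 := ham p.1
    have h2 := ham p.2
    rw [norm_inv, Complex.norm_real, Real.norm_eq_abs, abs_of_pos (by linarith)]
    exact inv_anti₀ (by linarith) (by linarith)

variable [SFinite μ]

lemma abs_cauchyForm_le (hu : Integrable u μ) (hm : 0 < m) (ham : ∀ y, m ≤ a y) :
    |cauchyForm μ a u| ≤ (2 * m)⁻¹ * (∫ y, ‖u y‖ ∂μ) ^ 2 := by
  refine (Complex.abs_re_le_norm _).trans ?_
  have h : Integrable (fun p : Y × Y => (2 * m)⁻¹ * (‖u p.1‖ * ‖u p.2‖)) (μ.prod μ) :=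
    (hu.norm.mul_prod hu.norm).const_mul _
  refine (norm_integral_le_of_norm_le h (ae_of_all _ fun p => ?_)).trans (le_of_eq ?_)
  · have h1 := ham p.1
    have h2 := ham p.2
    rw [norm_div, norm_mul, RCLike.norm_conj, Complex.norm_real, Real.norm_eq_abs,
      abs_of_pos (by linarith), div_eq_inv_mul]
    gcongr
    linarith
  · rw [integral_const_mul, integral_prod_mul (fun y => ‖u y‖) (fun y => ‖u y‖), sq]

/-- Splitting a nonnegative rank-one form off the Cauchy form: with `p = (a - c) / (a + c)` one has
`1 / (a + b) = 2c / ((a + c)(b + c)) + p(a) p(b) / (a + b)`. -/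
lemma cauchyForm_step (hu : Integrable u μ) (ha : Measurable a) (hm : 0 < m)
    (ham : ∀ y, m ≤ a y) (hc : 0 < c) :
    cauchyForm μ a u = 2 * c * ‖∫ y, u y * ((a y + c)⁻¹ : ℝ) ∂μ‖ ^ 2 +
      cauchyForm μ a (fun y => u y * (cayley c a y : ℂ)) := by
  have hv : Integrable (fun y => u y * ((a y + c)⁻¹ : ℝ)) μ :=
    integrable_ofReal_mul (ha.add_const c).inv (C := c⁻¹) (fun y => by
      have := ham y
      rw [abs_of_pos (inv_pos.2 (by linarith))]
      exact inv_anti₀ hc (by linarith)) hu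
  have hw : Integrable (fun y => u y * (cayley c a y : ℂ)) μ :=
    integrable_ofReal_mul (measurable_cayley ha) (abs_cayley_le_one hm hc ham) hu
  have h1 := ((integrable_conj hv).mul_prod hv).const_mul (2 * c : ℂ)
  have h2 := integrable_cauchy hw ha hm ham
  have key : ∫ p, starRingEnd ℂ (u p.1) * u p.2 / ((a p.1 + a p.2 : ℝ) : ℂ) ∂(μ.prod μ) =
      2 * c * ∫ p : Y × Y, starRingEnd ℂ (u p.1 * ((a p.1 + c)⁻¹ : ℝ)) *
        (u p.2 * ((a p.2 + c)⁻¹ : ℝ)) ∂(μ.prod μ) +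
      ∫ p : Y × Y, starRingEnd ℂ (u p.1 * (cayley c a p.1 : ℂ)) * (u p.2 * (cayley c a p.2 : ℂ)) /
        ((a p.1 + a p.2 : ℝ) : ℂ) ∂(μ.prod μ) := by
    rw [← integral_const_mul, ← integral_add h1 h2]
    refine integral_congr_ae (ae_of_all _ fun p => ?_)
    have e1 : ((a p.1 + c : ℝ) : ℂ) ≠ 0 := by
      have := ham p.1
      exact_mod_cast (show a p.1 + c ≠ 0 by linarith)
    have e2 : ((a p.2 + c : ℝ) : ℂ) ≠ 0 := by
      have := ham p.2
      exact_mod_cast (show a p.2 + c ≠ 0 by linarith)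
    have e3 : ((a p.1 + a p.2 : ℝ) : ℂ) ≠ 0 := by
      have := ham p.1
      have := ham p.2
      exact_mod_cast (show a p.1 + a p.2 ≠ 0 by linarith)
    simp only [cayley, map_mul, Complex.conj_ofReal]
    push_cast at e1 e2 e3 ⊢
    field_simp
    ring
  have h3 : ∫ p : Y × Y, starRingEnd ℂ (u p.1 * ((a p.1 + c)⁻¹ : ℝ)) *
        (u p.2 * ((a p.2 + c)⁻¹ : ℝ)) ∂(μ.prod μ)
      = ((‖∫ y, u y * ((a y + c)⁻¹ : ℝ) ∂μ‖ ^ 2 : ℝ) : ℂ) := by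
    rw [integral_prod_mul (fun y => starRingEnd ℂ (u y * ((a y + c)⁻¹ : ℝ)))
      (fun y => u y * ((a y + c)⁻¹ : ℝ)), integral_conj, Complex.conj_mul']
    push_cast
    rfl
  rw [cauchyForm, key, h3, Complex.add_re, cauchyForm]
  congr 1
  norm_cast

lemma cauchyForm_eq_sum (hu : Integrable u μ) (ha : Measurable a) (hm : 0 < m)
    (ham : ∀ y, m ≤ a y) (hc : 0 < c) (N : ℕ) :
    cauchyForm μ a u = ∑ n ∈ Finset.range N,
        2 * c * ‖∫ y, u y * ((cayley c a y ^ n * (a y + c)⁻¹ : ℝ) : ℂ) ∂μ‖ ^ 2 +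
      cauchyForm μ a (fun y => u y * ((cayley c a y ^ N : ℝ) : ℂ)) := by
  induction N with
  | zero => simp
  | succ N ih =>
    rw [ih, cauchyForm_step (integrable_mul_cayley_pow hu ha hm ham hc N) ha hm ham hc,
      Finset.sum_range_succ, add_assoc]
    congr 2
    · congr 4
      funext y
      push_cast
      ring
    · congr 1
      funext y
      push_cast
      ring

/-- The Cauchy form is nonnegative: it exceeds the form of `u p ^ N`, which tends to `0`. -/
lemma cauchyForm_nonneg (hu : Integrable u μ) (ha : Measurable a) (hm : 0 < m)
    (ham : ∀ y, m ≤ a y) {M : ℝ} (haM : ∀ y, a y ≤ M) : 0 ≤ cauchyForm μ a u := by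
  rcases isEmpty_or_nonempty Y with hY | ⟨⟨y₀⟩⟩
  · simp [cauchyForm, Measure.eq_zero_of_isEmpty]
  have hmM : m ≤ M := (ham y₀).trans (haM y₀)
  set ρ : ℝ := (M - m) / (M + m) with hρ
  have hρ0 : 0 ≤ ρ := div_nonneg (by linarith) (by linarith)
  have hρ1 : ρ < 1 := (div_lt_one (by linarith)).2 (by linarith)
  have hp : ∀ y, |cayley m a y| ≤ ρ := fun y => by
    have h1 := ham y
    have h2 := haM y
    rw [cayley, abs_of_nonneg (div_nonneg (by linarith) (by linarith)), hρ,
      div_le_div_iff₀ (by linarith) (by linarith)]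
    nlinarith
  have hlow : ∀ N : ℕ, -((2 * m)⁻¹ * (ρ ^ N * ∫ y, ‖u y‖ ∂μ) ^ 2) ≤ cauchyForm μ a u := by
    intro N
    have h1 := abs_cauchyForm_le (integrable_mul_cayley_pow hu ha hm ham hm N) hm ham
    have h2 : ∫ y, ‖u y * ((cayley m a y ^ N : ℝ) : ℂ)‖ ∂μ ≤ ρ ^ N * ∫ y, ‖u y‖ ∂μ := by
      rw [← integral_const_mul]
      refine integral_mono (integrable_mul_cayley_pow hu ha hm ham hm N).norm
        (hu.norm.const_mul _) fun y => ?_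
      simp only [norm_mul, Complex.norm_real, Real.norm_eq_abs, abs_pow]
      rw [mul_comm]
      gcongr
      exact hp y
    have h3 : 0 ≤ ∫ y, ‖u y * ((cayley m a y ^ N : ℝ) : ℂ)‖ ∂μ :=
      integral_nonneg fun y => norm_nonneg _
    have h4 : (2 * m)⁻¹ * (∫ y, ‖u y * ((cayley m a y ^ N : ℝ) : ℂ)‖ ∂μ) ^ 2
        ≤ (2 * m)⁻¹ * (ρ ^ N * ∫ y, ‖u y‖ ∂μ) ^ 2 := by gcongr
    have h5 : 0 ≤ ∑ n ∈ Finset.range N,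
        2 * m * ‖∫ y, u y * ((cayley m a y ^ n * (a y + m)⁻¹ : ℝ) : ℂ) ∂μ‖ ^ 2 :=
      Finset.sum_nonneg fun n _ => by positivity
    have h6 := cauchyForm_eq_sum hu ha hm ham hm N
    have h7 := neg_abs_le (cauchyForm μ a (fun y => u y * ((cayley m a y ^ N : ℝ) : ℂ)))
    linarith
  have hlim : Tendsto (fun N : ℕ => -((2 * m)⁻¹ * (ρ ^ N * ∫ y, ‖u y‖ ∂μ) ^ 2)) atTop
      (𝓝 (-((2 * m)⁻¹ * (0 * ∫ y, ‖u y‖ ∂μ) ^ 2))) :=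
    ((((tendsto_pow_atTop_nhds_zero_of_lt_one hρ0 hρ1).mul_const _).pow 2).const_mul _).neg
  have := le_of_tendsto' hlim hlow
  simpa using this

/-- If the first `N` coefficients of the rank-one expansion around the minimum `c` of `a` vanish,
the Cauchy form of `l f` is small relative to the weight `a - c`. -/
lemma cauchyForm_le_of_vanishing {l f : Y → ℂ} (hl : MemLp l 2 μ) (hf : MemLp f 2 μ)
    (ha : Measurable a) (hc : 0 < c) (hca : ∀ y, c ≤ a y) {ρ M : ℝ} (hρ0 : 0 ≤ ρ) (hρ1 : ρ ≤ 1)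
    (hρ : ∀ y, cayley c a y ≤ ρ) (haM : ∀ y, a y ≤ M) (N : ℕ)
    (h0 : ∀ n < N + 1, ∫ y, l y * f y * ((cayley c a y ^ n * (a y + c)⁻¹ : ℝ) : ℂ) ∂μ = 0) :
    cauchyForm μ a (fun y => l y * f y) ≤
      (2 * c)⁻¹ * ((∫ y, ‖l y‖ ^ 2 ∂μ) * (ρ ^ N * (2 * c)⁻¹)) *
        ∫ y, (a y - c) * ‖f y‖ ^ 2 ∂μ := by
  have hu : Integrable (fun y => l y * f y) μ := hl.integrable_mul hf
  have hp0 : ∀ y, 0 ≤ cayley c a y := fun y =>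
    div_nonneg (by linarith [hca y]) (by linarith [hca y])
  have hpow : ∀ y, (cayley c a y ^ (N + 1)) ^ 2 ≤ ρ ^ N * (2 * c)⁻¹ * (a y - c) := by
    intro y
    have h1 : cayley c a y ≤ (2 * c)⁻¹ * (a y - c) := by
      rw [cayley, div_eq_inv_mul]
      have := hca y
      gcongr
      all_goals linarith
    calc (cayley c a y ^ (N + 1)) ^ 2
        = cayley c a y ^ N * cayley c a y * cayley c a y ^ (N + 1) := by
          ring
      _ ≤ ρ ^ N * ((2 * c)⁻¹ * (a y - c)) * 1 := by
          have h3 : cayley c a y ^ (N + 1) ≤ 1 := pow_le_one₀ (hp0 y) ((hρ y).trans hρ1)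
          have h4 := hp0 y
          have h5 := hρ y
          gcongr
          exact mul_nonneg (pow_nonneg hρ0 _) (h4.trans h1)
      _ = _ := by ring
  rw [cauchyForm_eq_sum hu ha hc hca hc (N + 1), Finset.sum_eq_zero (fun n hn => by
    rw [h0 n (Finset.mem_range.1 hn)]; simp), zero_add]
  refine (le_abs_self _).trans ((abs_cauchyForm_le
    (integrable_mul_cayley_pow hu ha hc hca hc (N + 1)) hc hca).trans ?_)
  rw [mul_assoc]
  gcongr
  have hfp : MemLp (fun y => f y * ((cayley c a y ^ (N + 1) : ℝ) : ℂ)) 2 μ := by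
    refine hf.of_le (hf.1.mul (Complex.measurable_ofReal.comp
      ((measurable_cayley ha).pow_const _)).aestronglyMeasurable) (ae_of_all _ fun y => ?_)
    rw [norm_mul, Complex.norm_real, Real.norm_eq_abs, abs_pow]
    exact mul_le_of_le_one_right (norm_nonneg _)
      (pow_le_one₀ (abs_nonneg _) (abs_cayley_le_one hc hc hca y))
  have hCS := integral_mul_norm_le_Lp_mul_Lq (μ := μ) Real.HolderConjugate.two_two
    (f := l) (g := fun y => f y * ((cayley c a y ^ (N + 1) : ℝ) : ℂ)) (by simpa using hl)
    (by simpa using hfp)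
  simp only [Real.rpow_two, ← Real.sqrt_eq_rpow] at hCS
  have hI : ∀ g : Y → ℂ, 0 ≤ ∫ y, ‖g y‖ ^ 2 ∂μ := fun g => integral_nonneg fun y => by positivity
  have hfi : Integrable (fun y => ‖f y‖ ^ 2) μ := hf.integrable_norm_pow (by norm_num)
  have hwi : Integrable (fun y => (a y - c) * ‖f y‖ ^ 2) μ :=
    hfi.bdd_mul (c := M) (ha.sub_const c).aestronglyMeasurable (ae_of_all _ fun y => by
      rw [Real.norm_eq_abs, abs_of_nonneg (by linarith [hca y])]
      linarith [haM y])
  have h2 : ∫ y, ‖f y * ((cayley c a y ^ (N + 1) : ℝ) : ℂ)‖ ^ 2 ∂μ ≤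
      ρ ^ N * (2 * c)⁻¹ * ∫ y, (a y - c) * ‖f y‖ ^ 2 ∂μ := by
    rw [← integral_const_mul]
    refine integral_mono (hfp.integrable_norm_pow (by norm_num)) (hwi.const_mul _) fun y => ?_
    simp only [norm_mul, Complex.norm_real, Real.norm_eq_abs, mul_pow, sq_abs]
    calc ‖f y‖ ^ 2 * (cayley c a y ^ (N + 1)) ^ 2
        ≤ ‖f y‖ ^ 2 * (ρ ^ N * (2 * c)⁻¹ * (a y - c)) := by gcongr; exact hpow y
      _ = _ := by ring
  calc (∫ y, ‖l y * f y * ((cayley c a y ^ (N + 1) : ℝ) : ℂ)‖ ∂μ) ^ 2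
      ≤ (√(∫ y, ‖l y‖ ^ 2 ∂μ) *
          √(∫ y, ‖f y * ((cayley c a y ^ (N + 1) : ℝ) : ℂ)‖ ^ 2 ∂μ)) ^ 2 := by
        refine pow_le_pow_left₀ (integral_nonneg fun y => norm_nonneg _) ?_ 2
        refine le_trans (le_of_eq ?_) hCS
        simp only [norm_mul, mul_assoc]
    _ = (∫ y, ‖l y‖ ^ 2 ∂μ) * ∫ y, ‖f y * ((cayley c a y ^ (N + 1) : ℝ) : ℂ)‖ ^ 2 ∂μ := by
        rw [mul_pow, Real.sq_sqrt (hI _), Real.sq_sqrt (hI _)]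
    _ ≤ (∫ y, ‖l y‖ ^ 2 ∂μ) * (ρ ^ N * (2 * c)⁻¹ * ∫ y, (a y - c) * ‖f y‖ ^ 2 ∂μ) :=
        mul_le_mul_of_nonneg_left h2 (hI _)
    _ = _ := by ring

end CauchyForm

/-! ### The operator matrix: pointwise formulas and symmetry -/

section Matrix

variable {d : ℕ} (ω : X d →ᵇ ℝ) (lam : L2 d) (γ α : ℝ)

lemma opMatrix_fst (ψ : H d) :
    (opMatrix ω lam γ α ψ).fst = opA ω γ ψ.fst + opB lam α ψ.snd := rfl

lemma opMatrix_snd (ψ : H d) :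
    (opMatrix ω lam γ α ψ).snd = opC lam α ψ.fst + opD ω γ ψ.snd := rfl

lemma opA_ae (f : L2 d) : ∀ᵐ k, opA ω γ f k = ((-γ + ω k : ℝ) : ℂ) * f k := mulOp_ae _ f

lemma opB_ae (g : L2sym d) : ∀ᵐ k, opB lam α g k = α * ∫ q, (g : L2half d) (k, q) * lam q :=
  (memLp_funB lam α g).coeFn_toLp

lemma opC_ae (f : L2 d) : ∀ᵐ p ∂(halfVol d), (opC lam α f : L2half d) p = funC lam α f p :=
  (memLp_funC lam α f).coeFn_toLp

lemma opD_ae (g : L2sym d) : ∀ᵐ p ∂(halfVol d), (opD ω γ g : L2half d) p =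
    ((γ + ω p.1 + ω p.2 : ℝ) : ℂ) * (g : L2half d) p :=
  mulOp_ae (symbolD ω γ) (g : L2half d)

lemma norm_opC_le (f : L2 d) : ‖opC lam α f‖ ≤ 2 * |α| * ‖lam‖ * ‖f‖ := by
  change ‖(memLp_funC lam α f).toLp (funC lam α f)‖ ≤ _
  rw [Lp.norm_toLp]
  exact ENNReal.toReal_le_of_le_ofReal (by positivity) (eLpNorm_funC_le lam α f)

lemma integral_halfVol {E : Type*} [NormedAddCommGroup E] [NormedSpace ℝ E] (F : X d × X d → E) :
    ∫ p, F p ∂(halfVol d) = (2⁻¹ : ℝ) • ∫ p, F p ∂((volume : Measure (X d)).prod volume) := by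
  rw [halfVol, integral_smul_measure, Measure.volume_eq_prod]
  simp

lemma integrable_halfVol_iff {E : Type*} [NormedAddCommGroup E] {F : X d × X d → E} :
    Integrable F (halfVol d) ↔ Integrable F ((volume : Measure (X d)).prod volume) := by
  rw [halfVol, integrable_smul_measure (by simp) (by simp), Measure.volume_eq_prod]

lemma memLp_tensor (a b : L2 d) :
    MemLp (fun p : X d × X d => starRingEnd ℂ (a p.1) * b p.2) 2 (halfVol d) :=
  ⟨aesm_tensor a b, (eLpNorm_tensor_le a b).trans_lt ENNReal.ofReal_lt_top⟩

/-- `B` is the adjoint of `C`; the factor `1/2` in the inner product of the two-boson space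
compensates for the two equal terms produced by symmetrization. -/
lemma inner_opC_left (f : L2 d) (g : L2sym d) :
    inner ℂ (opC lam α f) g = inner ℂ f (opB lam α g) := by
  set F : X d × X d → ℂ :=
    fun p => α * (starRingEnd ℂ (f p.1) * lam p.2 * (g : L2half d) p) with hF
  have hFi : Integrable F ((volume : Measure (X d)).prod volume) :=
    integrable_halfVol_iff.1
      (((memLp_tensor f lam).integrable_mul (Lp.memLp (g : L2half d))).const_mul _)
  have hg : ∀ᵐ p ∂(halfVol d), (g : L2half d) p.swap = (g : L2half d) p := g.2
  have h1 : inner ℂ (opC lam α f) g =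
      (2⁻¹ : ℝ) • ∫ p, (F p + F p.swap) ∂((volume : Measure (X d)).prod volume) := by
    rw [Submodule.coe_inner, L2.inner_def, ← integral_halfVol]
    refine integral_congr_ae ?_
    filter_upwards [opC_ae lam α f, hg] with p hp hp'
    simp only [RCLike.inner_apply, hF, hp, hp', funC, Prod.fst_swap, Prod.snd_swap, map_add,
      map_mul, Complex.conj_ofReal, Complex.conj_conj]
    ring
  have hsw : ∫ p, F p.swap ∂((volume : Measure (X d)).prod volume) =
      ∫ p, F p ∂((volume : Measure (X d)).prod volume) := integral_prod_swap F
  have hadd : ∫ p, (F p + F p.swap) ∂((volume : Measure (X d)).prod volume) = _ :=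
    integral_add hFi hFi.swap
  rw [h1, hadd, hsw, integral_prod F hFi, L2.inner_def,
    ← two_smul ℝ, smul_smul, inv_mul_cancel₀ two_ne_zero, one_smul]
  refine integral_congr_ae ?_
  filter_upwards [opB_ae lam α g] with k hk
  rw [RCLike.inner_apply, hk, mul_comm, mul_left_comm, ← integral_const_mul, ← integral_const_mul]
  refine integral_congr_ae (ae_of_all _ fun q => ?_)
  simp only [hF]
  ring

lemma inner_mulOp_left {Y : Type*} [TopologicalSpace Y] [MeasurableSpace Y]
    [OpensMeasurableSpace Y] {μ : Measure Y} (b : Y →ᵇ ℝ) (f g : Lp ℂ 2 μ) :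
    inner ℂ (mulOp μ b f) g = inner ℂ f (mulOp μ b g) := by
  rw [L2.inner_def, L2.inner_def]
  refine integral_congr_ae ?_
  filter_upwards [mulOp_ae b f, mulOp_ae b g] with y h1 h2
  rw [h1, h2, RCLike.inner_apply, RCLike.inner_apply, map_mul, Complex.conj_ofReal]
  ring

lemma inner_opMatrix (φ ψ : H d) : inner ℂ φ (opMatrix ω lam γ α ψ) =
    inner ℂ φ.fst (opA ω γ ψ.fst) + inner ℂ φ.fst (opB lam α ψ.snd) +
      (inner ℂ φ.snd (opC lam α ψ.fst) + inner ℂ φ.snd (opD ω γ ψ.snd)) := by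
  rw [WithLp.prod_inner_apply]
  change inner ℂ φ.fst (opMatrix ω lam γ α ψ).fst + inner ℂ φ.snd (opMatrix ω lam γ α ψ).snd = _
  rw [opMatrix_fst, opMatrix_snd, inner_add_right, inner_add_right]

lemma inner_opB_left (f : L2 d) (g : L2sym d) :
    inner ℂ (opB lam α g) f = inner ℂ g (opC lam α f) := by
  rw [← inner_conj_symm, ← inner_opC_left]
  exact inner_conj_symm g (opC lam α f)

lemma isSymmetric_opMatrix : 
    LinearMap.IsSymmetric (𝕜 := ℂ) (E := H d) (opMatrix ω lam γ α : Module.End ℂ (H d)) := by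
  intro φ ψ
  have hA : inner ℂ ψ.fst (opA ω γ φ.fst) = inner ℂ (opA ω γ ψ.fst) φ.fst :=
    (inner_mulOp_left _ _ _).symm
  have hD : inner ℂ ψ.snd (opD ω γ φ.snd) = inner ℂ (opD ω γ ψ.snd) φ.snd :=
    (inner_mulOp_left (symbolD ω γ) (ψ.snd : L2half d) (φ.snd : L2half d)).symm
  change inner ℂ (opMatrix ω lam γ α φ) ψ = inner ℂ φ (opMatrix ω lam γ α ψ)
  refine (inner_conj_symm (𝕜 := ℂ) (E := H d) (opMatrix ω lam γ α φ) ψ).symm.trans ?_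
  have e1 := inner_conj_symm (𝕜 := ℂ) φ.fst (opA ω γ ψ.fst)
  have e2 := inner_conj_symm (𝕜 := ℂ) φ.snd (opC lam α ψ.fst)
  have e3 := inner_conj_symm (𝕜 := ℂ) φ.fst (opB lam α ψ.snd)
  have e4 := inner_conj_symm (𝕜 := ℂ) φ.snd (opD ω γ ψ.snd)
  rw [inner_opMatrix, inner_opMatrix, hA, hD, ← inner_opC_left,
    ← inner_opB_left, map_add, map_add, map_add, e1, e2, e3, e4]
  ring

lemma integral_mul_eq_inner (f : L2 d) : ∫ q, f q * lam q = inner ℂ (star lam) f := by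
  rw [L2.inner_def]
  refine integral_congr_ae ?_
  filter_upwards [Lp.coeFn_star lam] with q hq
  rw [RCLike.inner_apply, hq, Pi.star_apply]
  simp

/-- `B` applied to a symmetrized product function. -/
lemma opB_opC (l f : L2 d) (β : ℝ) : opB lam α (opC l β f) =
    ((α * β : ℝ) : ℂ) • ((inner ℂ (star lam) f : ℂ) • star l + (inner ℂ l lam : ℂ) • f) := by
  refine Lp.ext ?_
  filter_upwards [opB_ae lam α (opC l β f), ae_slice _ (opC_ae l β f), Lp.coeFn_star l,
    Lp.coeFn_smul ((α * β : ℝ) : ℂ)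
      ((inner ℂ (star lam) f : ℂ) • star l + (inner ℂ l lam : ℂ) • f),
    Lp.coeFn_add ((inner ℂ (star lam) f : ℂ) • star l) ((inner ℂ l lam : ℂ) • f),
    Lp.coeFn_smul (inner ℂ (star lam) f : ℂ) (star l), Lp.coeFn_smul (inner ℂ l lam : ℂ) f]
    with k h1 h2 h3 h4 h5 h6 h7
  rw [h1, h4, Pi.smul_apply, h5, Pi.add_apply, h6, h7, Pi.smul_apply, Pi.smul_apply, h3,
    Pi.star_apply, smul_eq_mul, smul_eq_mul, smul_eq_mul]
  have i1 : Integrable (fun q => f q * lam q) := (Lp.memLp f).integrable_mul (Lp.memLp lam)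
  have i2 : Integrable (fun q => inner ℂ (l q) (lam q)) := L2.integrable_inner l lam
  have e : ∫ q, (opC l β f : L2half d) (k, q) * lam q =
      β * starRingEnd ℂ (l k) * inner ℂ (star lam) f + β * f k * inner ℂ l lam := by
    rw [← integral_mul_eq_inner, L2.inner_def, ← integral_const_mul, ← integral_const_mul,
      ← integral_add (i1.const_mul _) (i2.const_mul _)]
    refine integral_congr_ae ?_
    filter_upwards [h2] with q hq
    rw [hq, funC, RCLike.inner_apply]
    ring
  rw [e]
  push_cast
  simp only [RCLike.star_def]
  ring

lemma norm_opC_star_self (f : L2 d) : ‖opC (star f) 1 f‖ ^ 2 = 2 * ‖f‖ ^ 4 := by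
  have h : (inner ℂ (opC (star f) 1 f) (opC (star f) 1 f) : ℂ) = 2 * (‖f‖ : ℂ) ^ 4 := by
    have h' : (inner ℂ (star f) (star f) : ℂ) = (‖f‖ : ℂ) ^ 2 := by
      have hf : inner ℂ f f = (‖f‖ : ℂ) ^ 2 := inner_self_eq_norm_sq_to_K f
      rw [← integral_mul_eq_inner f (star f), ← hf, L2.inner_def]
      refine integral_congr_ae ?_
      filter_upwards [Lp.coeFn_star f] with q hq
      rw [hq, Pi.star_apply, RCLike.inner_apply, RCLike.star_def]
      ring
    have hf : inner ℂ f f = (‖f‖ : ℂ) ^ 2 := inner_self_eq_norm_sq_to_K f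
    rw [inner_opC_left, opB_opC, star_star, inner_smul_right, inner_add_right, inner_smul_right,
      inner_smul_right, h', hf]
    push_cast
    ring
  have h2 : inner ℂ (opC (star f) 1 f) (opC (star f) 1 f) = (‖opC (star f) 1 f‖ : ℂ) ^ 2 :=
    inner_self_eq_norm_sq_to_K (opC (star f) 1 f)
  rw [h2] at h
  exact_mod_cast h

end Matrix

/-! ### Completing the square in the quadratic form -/

section Form

variable {d : ℕ} (ω : X d →ᵇ ℝ) (lam : L2 d) (γ α : ℝ)

/-- The function `a` with `a k + a q = σ (γ + ω k + ω q - z)`, where `σ = ±1` is chosen so that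
`σ (D - z)` is positive. -/
noncomputable def halfSymbol (σ z : ℝ) (k : X d) : ℝ := σ * (ω k + (γ - z) / 2)

lemma measurable_halfSymbol (σ z : ℝ) : Measurable (halfSymbol ω γ σ z) :=
  ((ω.continuous.add_const _).const_mul _).measurable

lemma halfSymbol_add (σ z : ℝ) (k q : X d) :
    halfSymbol ω γ σ z k + halfSymbol ω γ σ z q = σ * (γ + ω k + ω q - z) := by
  rw [halfSymbol, halfSymbol]; ring

lemma abs_eq_one_of_sq {σ : ℝ} (hσ : σ ^ 2 = 1) : |σ| = 1 :=
  (pow_eq_one_iff_of_nonneg (abs_nonneg σ) two_ne_zero).1 (by rwa [sq_abs])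

lemma exists_halfSymbol_le {σ : ℝ} (hσ : σ ^ 2 = 1) (z : ℝ) :
    ∃ M, ∀ k, halfSymbol ω γ σ z k ≤ M := by
  refine ⟨‖ω‖ + |(γ - z) / 2|, fun k => (le_abs_self _).trans ?_⟩
  rw [halfSymbol, abs_mul, abs_eq_one_of_sq hσ, one_mul]
  exact (abs_add_le _ _).trans (add_le_add_left (ω.norm_coe_le_norm k) _)

variable {ω γ}

lemma integral_sub_mul {Y : Type*} [MeasurableSpace Y] {μ : Measure Y} {F G : Y → ℝ}
    (hF : Integrable F μ) (hG : Integrable G μ) (s t : ℝ) :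
    ∫ y, (s * F y - t * G y) ∂μ = s * ∫ y, F y ∂μ - t * ∫ y, G y ∂μ := by
  rw [integral_sub (hF.const_mul s) (hG.const_mul t), integral_const_mul, integral_const_mul]

lemma integrable_norm_sq {Y : Type*} [MeasurableSpace Y] {μ : Measure Y} (f : Lp ℂ 2 μ) :
    Integrable (fun y => ‖f y‖ ^ 2) μ :=
  (Lp.memLp f).integrable_norm_pow (by norm_num)

lemma re_inner_self_eq_integral {Y : Type*} [MeasurableSpace Y] {μ : Measure Y} (f : Lp ℂ 2 μ) :
    (inner ℂ f f : ℂ).re = ∫ y, ‖f y‖ ^ 2 ∂μ := by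
  rw [L2.inner_def, ← Complex.reCLM_apply,
    ← Complex.reCLM.integral_comp_comm (L2.integrable_inner f f)]
  refine integral_congr_ae (ae_of_all _ fun y => ?_)
  simp only [RCLike.inner_apply, Complex.mul_conj', Complex.reCLM_apply]
  norm_cast

lemma re_inner_mulOp {Y : Type*} [TopologicalSpace Y] [MeasurableSpace Y]
    [OpensMeasurableSpace Y] {μ : Measure Y} (b : Y →ᵇ ℝ) (f : Lp ℂ 2 μ) :
    (inner ℂ f (mulOp μ b f) : ℂ).re = ∫ y, b y * ‖f y‖ ^ 2 ∂μ := by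
  rw [L2.inner_def, ← Complex.reCLM_apply,
    ← Complex.reCLM.integral_comp_comm (L2.integrable_inner _ _)]
  refine integral_congr_ae ?_
  filter_upwards [mulOp_ae b f] with y hy
  rw [RCLike.inner_apply, hy, mul_assoc, Complex.mul_conj', Complex.reCLM_apply]
  norm_cast

lemma integrable_bcf_mul_norm_sq {Y : Type*} [TopologicalSpace Y] [MeasurableSpace Y]
    [OpensMeasurableSpace Y] {μ : Measure Y} (b : Y →ᵇ ℝ) (f : Lp ℂ 2 μ) :
    Integrable (fun y => b y * ‖f y‖ ^ 2) μ :=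
  (integrable_norm_sq f).bdd_mul (c := ‖b‖) b.continuous.aestronglyMeasurable
    (ae_of_all _ b.norm_coe_le_norm)

variable {σ z m : ℝ}

lemma integrable_direct (hm : 0 < m) (ham : ∀ k, m ≤ halfSymbol ω γ σ z k) (f : L2 d) :
    Integrable (fun p : X d × X d => ‖f p.1‖ ^ 2 * ‖lam p.2‖ ^ 2 *
      (halfSymbol ω γ σ z p.1 + halfSymbol ω γ σ z p.2)⁻¹)
      ((volume : Measure (X d)).prod volume) := by
  refine ((integrable_norm_sq f).mul_prod (integrable_norm_sq lam)).mul_bdd (c := (2 * m)⁻¹) ?_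
    (ae_of_all _ fun p => ?_)
  · have ha := measurable_halfSymbol ω γ σ z
    exact ((ha.comp measurable_fst).add (ha.comp measurable_snd)).inv.aestronglyMeasurable
  · have h1 := ham p.1
    have h2 := ham p.2
    rw [Real.norm_eq_abs, abs_of_pos (inv_pos.2 (by linarith))]
    exact inv_anti₀ (by linarith) (by linarith)

lemma integral_direct (hm : 0 < m) (ham : ∀ k, m ≤ halfSymbol ω γ σ z k) (f : L2 d) :
    ∫ p : X d × X d, ‖f p.1‖ ^ 2 * ‖lam p.2‖ ^ 2 *
      (halfSymbol ω γ σ z p.1 + halfSymbol ω γ σ z p.2)⁻¹ ∂((volume : Measure (X d)).prod volume) =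
    ∫ k, (∫ q, ‖lam q‖ ^ 2 / (halfSymbol ω γ σ z k + halfSymbol ω γ σ z q)) * ‖f k‖ ^ 2 := by
  rw [integral_prod _ (integrable_direct lam hm ham f)]
  refine integral_congr_ae (ae_of_all _ fun k => ?_)
  simp only
  rw [mul_comm, ← integral_const_mul]
  refine integral_congr_ae (ae_of_all _ fun q => ?_)
  simp only [div_eq_mul_inv, mul_assoc]

lemma integrable_direct_fst (hm : 0 < m) (ham : ∀ k, m ≤ halfSymbol ω γ σ z k) (f : L2 d) :
    Integrable fun k =>
      (∫ q, ‖lam q‖ ^ 2 / (halfSymbol ω γ σ z k + halfSymbol ω γ σ z q)) * ‖f k‖ ^ 2 := by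
  refine (integrable_direct lam hm ham f).integral_prod_left.congr (ae_of_all _ fun k => ?_)
  simp only
  rw [mul_comm, ← integral_const_mul]
  refine integral_congr_ae (ae_of_all _ fun q => ?_)
  simp only [div_eq_mul_inv, mul_assoc]

lemma norm_funC_sq (f : L2 d) (p : X d × X d) : ‖funC lam α f p‖ ^ 2 =
    α ^ 2 * (‖f p.1‖ ^ 2 * ‖lam p.2‖ ^ 2 + ‖f p.2‖ ^ 2 * ‖lam p.1‖ ^ 2 +
      2 * (starRingEnd ℂ (lam p.1 * f p.1) * (lam p.2 * f p.2)).re) := by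
  simp only [funC, ← Complex.normSq_eq_norm_sq, Complex.normSq_apply, map_mul, Complex.add_re,
    Complex.add_im, Complex.mul_re, Complex.mul_im, Complex.conj_re, Complex.conj_im,
    Complex.ofReal_re, Complex.ofReal_im]
  ring

/-- The form of `C* (σ (D - z))⁻¹ C`: a multiplication operator plus the Cauchy form. -/
lemma integral_norm_funC_sq_div (hm : 0 < m) (ham : ∀ k, m ≤ halfSymbol ω γ σ z k) (f : L2 d) :
    ∫ p, ‖funC lam α f p‖ ^ 2 * (halfSymbol ω γ σ z p.1 + halfSymbol ω γ σ z p.2)⁻¹ ∂(halfVol d) =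
    α ^ 2 * (∫ k, (∫ q, ‖lam q‖ ^ 2 / (halfSymbol ω γ σ z k + halfSymbol ω γ σ z q)) * ‖f k‖ ^ 2) +
      α ^ 2 * cauchyForm volume (halfSymbol ω γ σ z) (fun k => lam k * f k) := by
  set a := halfSymbol ω γ σ z
  set G : X d × X d → ℝ := fun p => ‖f p.1‖ ^ 2 * ‖lam p.2‖ ^ 2 * (a p.1 + a p.2)⁻¹ with hG
  have hGi : Integrable G ((volume : Measure (X d)).prod volume) := integrable_direct lam hm ham f
  have hu : Integrable (fun k => lam k * f k) := (Lp.memLp lam).integrable_mul (Lp.memLp f)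
  have hK := integrable_cauchy hu (measurable_halfSymbol ω γ σ z) hm ham
  set K : X d × X d → ℂ := fun p => starRingEnd ℂ (lam p.1 * f p.1) * (lam p.2 * f p.2) /
    ((a p.1 + a p.2 : ℝ) : ℂ) with hKdef
  have hKre : ∫ p, (K p).re ∂((volume : Measure (X d)).prod volume) =
      cauchyForm volume a (fun k => lam k * f k) :=
    Complex.reCLM.integral_comp_comm hK
  have hKi : Integrable (fun p => (K p).re) ((volume : Measure (X d)).prod volume) := hK.re
  have hpt : ∀ p, ‖funC lam α f p‖ ^ 2 * (a p.1 + a p.2)⁻¹ =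
      α ^ 2 * (G p + G p.swap + 2 * (K p).re) := by
    intro p
    rw [norm_funC_sq]
    simp only [hG, hKdef, Prod.fst_swap, Prod.snd_swap, Complex.div_ofReal_re]
    rw [add_comm (a p.2) (a p.1)]
    ring
  have hsw : ∫ p, G p.swap ∂((volume : Measure (X d)).prod volume) =
      ∫ p, G p ∂((volume : Measure (X d)).prod volume) := integral_prod_swap G
  have h1 : ∫ p, (G p + G p.swap) ∂((volume : Measure (X d)).prod volume) = _ :=
    integral_add hGi hGi.swap
  have h2 : ∫ p, (G p + G p.swap + 2 * (K p).re) ∂((volume : Measure (X d)).prod volume) = _ :=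
    integral_add (hGi.add hGi.swap) (hKi.const_mul 2)
  rw [integral_congr_ae (ae_of_all _ hpt), integral_const_mul, integral_halfVol, h2, h1, hsw,
    integral_const_mul, hKre, ← integral_direct lam hm ham f]
  simp only [smul_eq_mul]
  ring

/-- The multiplication part of the Schur complement is `Φ(z - ω k)`. -/
lemma sigma_mul_Phi (hσ : σ ^ 2 = 1) (k : X d) : σ * Phi ω lam γ α (z - ω k) =
    σ * (-γ + ω k - z) -
      α ^ 2 * ∫ q, ‖lam q‖ ^ 2 / (halfSymbol ω γ σ z k + halfSymbol ω γ σ z q) := by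
  have h : ∫ q, ‖lam q‖ ^ 2 / (halfSymbol ω γ σ z k + halfSymbol ω γ σ z q) =
      σ * ∫ q, ‖lam q‖ ^ 2 / (ω q + γ - (z - ω k)) := by
    rw [← integral_const_mul]
    refine integral_congr_ae (ae_of_all _ fun q => ?_)
    simp only
    have hi : σ⁻¹ = σ := by
      have h0 : σ ≠ 0 := by rintro rfl; norm_num at hσ
      field_simp
      exact hσ.symm
    rw [halfSymbol_add, div_eq_mul_inv, mul_inv, hi, div_eq_mul_inv]
    ring_nf
  rw [h, Phi]
  ring

/-- Completing the square: the form of `σ (𝒜 - z)` is the form of the Schur complement plus a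
nonnegative remainder that vanishes exactly when the second row of `(𝒜 - z) ψ` does. -/
lemma form_identity (hσ : σ ^ 2 = 1) (hm : 0 < m) (ham : ∀ k, m ≤ halfSymbol ω γ σ z k)
    (ψ : H d) :
    σ * ((inner ℂ ψ (opMatrix ω lam γ α ψ) : ℂ).re - z * (inner ℂ ψ ψ : ℂ).re) =
      (∫ k, σ * Phi ω lam γ α (z - ω k) * ‖ψ.fst k‖ ^ 2) -
        α ^ 2 * cauchyForm volume (halfSymbol ω γ σ z) (fun k => lam k * ψ.fst k) +
      ∫ p, ‖((halfSymbol ω γ σ z p.1 + halfSymbol ω γ σ z p.2 : ℝ) : ℂ) * (ψ.snd : L2half d) p +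
          σ * funC lam α ψ.fst p‖ ^ 2 *
        (halfSymbol ω γ σ z p.1 + halfSymbol ω γ σ z p.2)⁻¹ ∂(halfVol d) := by
  set a := halfSymbol ω γ σ z with ha
  set f : L2 d := ψ.fst with hf
  set g : L2sym d := ψ.snd with hg
  have hpos : ∀ p : X d × X d, 0 < a p.1 + a p.2 := fun p => by linarith [ham p.1, ham p.2]
  have hψψ : (inner ℂ ψ ψ : ℂ).re =
      (∫ k, ‖f k‖ ^ 2) + ∫ p, ‖(g : L2half d) p‖ ^ 2 ∂(halfVol d) := by
    rw [WithLp.prod_inner_apply, Complex.add_re, ← re_inner_self_eq_integral,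
      ← re_inner_self_eq_integral]
    rfl
  have hA : (inner ℂ f (opA ω γ f) : ℂ).re = ∫ k, (-γ + ω k) * ‖f k‖ ^ 2 := re_inner_mulOp _ f
  have hD : (inner ℂ g (opD ω γ g) : ℂ).re =
      ∫ p, (γ + ω p.1 + ω p.2) * ‖(g : L2half d) p‖ ^ 2 ∂(halfVol d) :=
    re_inner_mulOp (symbolD ω γ) (g : L2half d)
  have hcross : ∀ᵐ p ∂(halfVol d), inner ℂ ((opC lam α f : L2half d) p) ((g : L2half d) p) =
      starRingEnd ℂ (funC lam α f p) * (g : L2half d) p := by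
    filter_upwards [opC_ae lam α f] with p hp
    rw [hp, RCLike.inner_apply']
  have hcrossi : Integrable (fun p => starRingEnd ℂ (funC lam α f p) * (g : L2half d) p)
      (halfVol d) :=
    (L2.integrable_inner (opC lam α f : L2half d) (g : L2half d)).congr hcross
  have hC : (inner ℂ (opC lam α f) g : ℂ).re =
      ∫ p, (starRingEnd ℂ (funC lam α f p) * (g : L2half d) p).re ∂(halfVol d) := by
    rw [Submodule.coe_inner, L2.inner_def, integral_congr_ae hcross, ← Complex.reCLM_apply,
      ← Complex.reCLM.integral_comp_comm hcrossi]
    rfl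
  have hB : (inner ℂ f (opB lam α g) : ℂ).re = (inner ℂ (opC lam α f) g : ℂ).re := by
    rw [inner_opC_left]
  have hC' : (inner ℂ g (opC lam α f) : ℂ).re = (inner ℂ (opC lam α f) g : ℂ).re := by
    have h : inner ℂ g (opC lam α f) = starRingEnd ℂ (inner ℂ (opC lam α f) g) :=
      (inner_conj_symm g (opC lam α f)).symm
    rw [h, Complex.conj_re]
  -- the three integrands of the expanded square
  have iC : Integrable (fun p => ‖funC lam α f p‖ ^ 2 * (a p.1 + a p.2)⁻¹) (halfVol d) := by
    refine ((memLp_funC lam α f).integrable_norm_pow (by norm_num)).mul_bdd (c := (2 * m)⁻¹) ?_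
      (ae_of_all _ fun p => ?_)
    · have ha := measurable_halfSymbol ω γ σ z
      exact ((ha.comp measurable_fst).add (ha.comp measurable_snd)).inv.aestronglyMeasurable
    · rw [Real.norm_eq_abs, abs_of_pos (inv_pos.2 (hpos p))]
      exact inv_anti₀ (by linarith) (by linarith [ham p.1, ham p.2])
  have iG1 := integrable_bcf_mul_norm_sq (μ := halfVol d) (symbolD ω γ) (g : L2half d)
  have iG := integrable_norm_sq (μ := halfVol d) (g : L2half d)
  have iX : Integrable (fun p => (starRingEnd ℂ (funC lam α f p) * (g : L2half d) p).re)
      (halfVol d) := hcrossi.re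
  have hsq : ∀ p, ‖((a p.1 + a p.2 : ℝ) : ℂ) * (g : L2half d) p + σ * funC lam α f p‖ ^ 2 *
      (a p.1 + a p.2)⁻¹ =
      (σ * (symbolD ω γ p * ‖(g : L2half d) p‖ ^ 2) - σ * z * ‖(g : L2half d) p‖ ^ 2) +
        2 * σ * (starRingEnd ℂ (funC lam α f p) * (g : L2half d) p).re +
        ‖funC lam α f p‖ ^ 2 * (a p.1 + a p.2)⁻¹ := by
    intro p
    have e : ‖((a p.1 + a p.2 : ℝ) : ℂ) * (g : L2half d) p + σ * funC lam α f p‖ ^ 2 =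
        (a p.1 + a p.2) * ((a p.1 + a p.2) * ‖(g : L2half d) p‖ ^ 2 +
          2 * σ * (starRingEnd ℂ (funC lam α f p) * (g : L2half d) p).re) +
          σ ^ 2 * ‖funC lam α f p‖ ^ 2 := by
      generalize funC lam α f p = c
      simp only [← Complex.normSq_eq_norm_sq, Complex.normSq_apply, Complex.add_re,
        Complex.add_im, Complex.mul_re, Complex.mul_im, Complex.conj_re, Complex.conj_im,
        Complex.ofReal_re, Complex.ofReal_im]
      ring
    rw [e, hσ, one_mul, add_mul, mul_right_comm, mul_inv_cancel₀ (hpos p).ne', one_mul,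
      symbolD_apply, ha, halfSymbol_add]
    ring
  have hIsq : ∫ p, ‖((a p.1 + a p.2 : ℝ) : ℂ) * (g : L2half d) p + σ * funC lam α f p‖ ^ 2 *
      (a p.1 + a p.2)⁻¹ ∂(halfVol d) =
      σ * (∫ p, symbolD ω γ p * ‖(g : L2half d) p‖ ^ 2 ∂(halfVol d)) -
        σ * z * (∫ p, ‖(g : L2half d) p‖ ^ 2 ∂(halfVol d)) +
        2 * σ * (∫ p, (starRingEnd ℂ (funC lam α f p) * (g : L2half d) p).re ∂(halfVol d)) +
        ∫ p, ‖funC lam α f p‖ ^ 2 * (a p.1 + a p.2)⁻¹ ∂(halfVol d) := by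
    rw [integral_congr_ae (ae_of_all _ hsq), ← integral_sub_mul iG1 iG σ (σ * z),
      ← integral_const_mul]
    have iS := (iG1.const_mul σ).sub (iG.const_mul (σ * z))
    have e1 := integral_add iS (iX.const_mul (2 * σ))
    have e2 := integral_add (iS.add (iX.const_mul (2 * σ))) iC
    simp only [Pi.add_apply, Pi.sub_apply] at e1 e2
    rw [e2, e1]
  have iF1 := integrable_bcf_mul_norm_sq
    (BoundedContinuousFunction.const (X d) (-γ) + ω) f
  have iF := integrable_norm_sq f
  have iL := integrable_direct_fst lam hm ham f
  have hPhi : ∫ k, σ * Phi ω lam γ α (z - ω k) * ‖f k‖ ^ 2 =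
      σ * (∫ k, (-γ + ω k) * ‖f k‖ ^ 2) - σ * z * (∫ k, ‖f k‖ ^ 2) -
        α ^ 2 * ∫ k, (∫ q, ‖lam q‖ ^ 2 / (a k + a q)) * ‖f k‖ ^ 2 := by
    have iF1' : Integrable fun k => (-γ + ω k) * ‖f k‖ ^ 2 := iF1
    have e := integral_sub ((iF1'.const_mul σ).sub (iF.const_mul (σ * z))) (iL.const_mul (α ^ 2))
    simp only [Pi.sub_apply] at e
    rw [← integral_sub_mul iF1' iF, ← integral_const_mul (α ^ 2), ← e]
    refine integral_congr_ae (ae_of_all _ fun k => ?_)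
    simp only [sigma_mul_Phi lam α hσ, ← ha]
    ring
  have hCC := integral_norm_funC_sq_div lam α hm ham f
  rw [← ha] at hCC
  rw [hIsq, hPhi, hCC, hψψ, inner_opMatrix, Complex.add_re, Complex.add_re, Complex.add_re,
    ← hf, ← hg, hA, hB, hC', hD, hC]
  simp only [symbolD_apply]
  ring

end Form

/-! ### Eigenvalues outside the spectrum of the two-boson block -/

section Eigenvalues

variable {d : ℕ} {ω : X d →ᵇ ℝ} (lam : L2 d) {γ : ℝ} (α : ℝ) {σ z m : ℝ}

lemma integrable_norm_sq_div {x : ℝ} {c : ℝ} (hσ : σ ^ 2 = 1) (hc : 0 < c)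
    (hx : ∀ k, c ≤ σ * (ω k + γ - x)) : Integrable fun q => ‖lam q‖ ^ 2 / (ω q + γ - x) := by
  simp only [div_eq_mul_inv]
  refine (integrable_norm_sq lam).mul_bdd (c := c⁻¹) ?_ (ae_of_all _ fun q => ?_)
  · exact (((ω.continuous.measurable.add_const γ).sub_const x).inv).aestronglyMeasurable
  · rw [norm_inv, Real.norm_eq_abs]
    refine inv_anti₀ hc ((hx q).trans ((le_abs_self _).trans ?_))
    rw [abs_mul, abs_eq_one_of_sq hσ, one_mul]

/-- On each of the two half-lines, `Φ` decreases at least as fast as `-id`. -/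
lemma sub_le_Phi_sub_Phi (hσ : σ ^ 2 = 1) {x y c : ℝ} (hc : 0 < c)
    (hx : ∀ k, c ≤ σ * (ω k + γ - x)) (hy : ∀ k, c ≤ σ * (ω k + γ - y)) (hxy : x ≤ y) :
    y - x ≤ Phi ω lam γ α x - Phi ω lam γ α y := by
  have h : ∫ q, ‖lam q‖ ^ 2 / (ω q + γ - x) ≤ ∫ q, ‖lam q‖ ^ 2 / (ω q + γ - y) := by
    refine integral_mono (integrable_norm_sq_div lam hσ hc hx)
      (integrable_norm_sq_div lam hσ hc hy) fun q => ?_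
    have h1 := hx q
    have h2 := hy q
    have h3 : 0 < (ω q + γ - x) * (ω q + γ - y) := by
      have := mul_pos (hc.trans_le h1) (hc.trans_le h2)
      calc (0 : ℝ) < σ ^ 2 * ((ω q + γ - x) * (ω q + γ - y)) := by linarith
        _ = _ := by rw [hσ, one_mul]
    have hx0 : ω q + γ - x ≠ 0 := left_ne_zero_of_mul h3.ne'
    have hy0 : ω q + γ - y ≠ 0 := right_ne_zero_of_mul h3.ne'
    have e : ‖lam q‖ ^ 2 / (ω q + γ - y) - ‖lam q‖ ^ 2 / (ω q + γ - x) =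
        ‖lam q‖ ^ 2 * (y - x) / ((ω q + γ - x) * (ω q + γ - y)) := by
      field_simp
      ring
    have : 0 ≤ ‖lam q‖ ^ 2 * (y - x) / ((ω q + γ - x) * (ω q + γ - y)) :=
      div_nonneg (mul_nonneg (by positivity) (by linarith)) h3.le
    simp only
    linarith
  have := mul_le_mul_of_nonneg_left h (sq_nonneg α)
  simp only [Phi]
  linarith

lemma integrable_sigma_Phi (hσ : σ ^ 2 = 1) (hm : 0 < m)
    (ham : ∀ k, m ≤ halfSymbol ω γ σ z k) (f : L2 d) :
    Integrable fun k => σ * Phi ω lam γ α (z - ω k) * ‖f k‖ ^ 2 := by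
  simp only [sigma_mul_Phi lam α hσ, sub_mul, mul_assoc]
  refine Integrable.sub ?_ ((integrable_direct_fst lam hm ham f).const_mul _)
  simp only [← sub_mul]
  exact (integrable_bcf_mul_norm_sq (BoundedContinuousFunction.const (X d) (-γ) + ω -
    BoundedContinuousFunction.const (X d) z) f).const_mul σ

lemma re_inner_eigenvector {ψ : H d} (hψ : opMatrix ω lam γ α ψ = (z : ℂ) • ψ) :
    (inner ℂ ψ (opMatrix ω lam γ α ψ) : ℂ).re - z * (inner ℂ ψ ψ : ℂ).re = 0 := by
  have h : inner ℂ ψ ((z : ℂ) • ψ) = (z : ℂ) * inner ℂ ψ ψ := inner_smul_right ψ ψ (z : ℂ)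
  rw [hψ, h, Complex.re_ofReal_mul, sub_self]

/-- Where the multiplication part of the Schur complement is strictly negative, the Cauchy form
only helps, so there are no eigenvectors. -/
lemma eq_zero_of_eigenvector (hσ : σ ^ 2 = 1) (hm : 0 < m)
    (ham : ∀ k, m ≤ halfSymbol ω γ σ z k) {δ : ℝ} (hδ : 0 < δ)
    (hPhi : ∀ k, σ * Phi ω lam γ α (z - ω k) ≤ -δ) {ψ : H d}
    (hψ : opMatrix ω lam γ α ψ = (z : ℂ) • ψ) : ψ = 0 := by
  have hid := form_identity lam α hσ hm ham ψ
  have hrow : ∀ᵐ p ∂(halfVol d),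
      ((halfSymbol ω γ σ z p.1 + halfSymbol ω γ σ z p.2 : ℝ) : ℂ) * (ψ.snd : L2half d) p +
          σ * funC lam α ψ.fst p = 0 := by
    have h2 : ((opC lam α ψ.fst + opD ω γ ψ.snd : L2sym d) : L2half d) =
        (z : ℂ) • (ψ.snd : L2half d) := by
      rw [← opMatrix_snd, hψ]
      rfl
    filter_upwards [opC_ae lam α ψ.fst, opD_ae ω γ ψ.snd,
      Lp.coeFn_add (opC lam α ψ.fst : L2half d) (opD ω γ ψ.snd : L2half d),
      Lp.coeFn_smul (z : ℂ) (ψ.snd : L2half d)] with p h3 h4 h5 h6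
    have h7 : ((opC lam α ψ.fst : L2half d) + (opD ω γ ψ.snd : L2half d) : L2half d) p =
        ((z : ℂ) • (ψ.snd : L2half d) : L2half d) p := by rw [← h2]; rfl
    rw [h5, h6, Pi.add_apply, Pi.smul_apply, h3, h4, smul_eq_mul] at h7
    rw [halfSymbol_add]
    push_cast at h7 ⊢
    linear_combination (σ : ℂ) * h7
  have hrem : ∫ p, ‖((halfSymbol ω γ σ z p.1 + halfSymbol ω γ σ z p.2 : ℝ) : ℂ) *
      (ψ.snd : L2half d) p + σ * funC lam α ψ.fst p‖ ^ 2 *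
        (halfSymbol ω γ σ z p.1 + halfSymbol ω γ σ z p.2)⁻¹ ∂(halfVol d) = 0 := by
    refine integral_eq_zero_of_ae ?_
    filter_upwards [hrow] with p hp
    rw [hp]
    simp
  obtain ⟨M, hM⟩ := exists_halfSymbol_le ω γ hσ z
  have hu : Integrable (fun k => lam k * ψ.fst k) :=
    (Lp.memLp lam).integrable_mul (Lp.memLp ψ.fst)
  have hcf := cauchyForm_nonneg hu (measurable_halfSymbol ω γ σ z) hm ham hM
  have hPhiI : ∫ k, σ * Phi ω lam γ α (z - ω k) * ‖ψ.fst k‖ ^ 2 ≤ -δ * ∫ k, ‖ψ.fst k‖ ^ 2 := by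
    rw [← integral_const_mul]
    refine integral_mono (integrable_sigma_Phi lam α hσ hm ham ψ.fst)
      ((integrable_norm_sq ψ.fst).const_mul _) fun k =>
      mul_le_mul_of_nonneg_right (hPhi k) (by positivity)
  rw [re_inner_eigenvector lam α hψ, mul_zero, hrem] at hid
  have hf0 : ψ.fst = 0 := by
    have h1 : (inner ℂ ψ.fst ψ.fst : ℂ).re ≤ 0 := by
      rw [re_inner_self_eq_integral]
      have := mul_nonneg (sq_nonneg α) hcf
      by_contra h
      push Not at h
      have := mul_pos hδ h
      linarith
    have h2 : (inner ℂ ψ.fst ψ.fst : ℂ).re = ‖ψ.fst‖ ^ 2 :=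
      inner_self_eq_norm_sq (𝕜 := ℂ) ψ.fst
    rw [h2] at h1
    exact norm_eq_zero.1 (pow_eq_zero_iff two_ne_zero |>.1 (le_antisymm h1 (by positivity)))
  have hg0 : (ψ.snd : L2half d) = 0 := by
    refine Lp.ext ?_
    have hz := Lp.coeFn_zero ℂ 2 (volume : Measure (X d))
    filter_upwards [hrow, (qmp_fst d).ae hz, (qmp_snd d).ae hz,
      Lp.coeFn_zero ℂ 2 (halfVol d)] with p h1 h2 h3 h4
    rw [funC, hf0, h2, h3] at h1
    have hp : ((halfSymbol ω γ σ z p.1 + halfSymbol ω γ σ z p.2 : ℝ) : ℂ) ≠ 0 := by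
      exact_mod_cast (show halfSymbol ω γ σ z p.1 + halfSymbol ω γ σ z p.2 ≠ 0 by
        linarith [ham p.1, ham p.2])
    rw [h4]
    simp only [Pi.zero_apply, mul_zero, add_zero, mul_eq_zero, hp, false_or] at h1 ⊢
    exact h1
  exact (WithLp.ofLp_injective 2) (Prod.ext hf0 (Subtype.ext hg0))

/-- If the multiplication part of the Schur complement dominates the distance of `a` from its
minimum, the form of `σ (𝒜 - z)` is nonnegative on a subspace of finite codimension. -/
lemma exists_functionals_form_nonneg (hσ : σ ^ 2 = 1) (hm : 0 < m)
    (ham : ∀ k, m ≤ halfSymbol ω γ σ z k)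
    (hPhi : ∀ k, halfSymbol ω γ σ z k - m ≤ σ * Phi ω lam γ α (z - ω k)) :
    ∃ (N : ℕ) (ℓ : Fin N → H d →ₗ[ℂ] ℂ), ∀ ψ : H d, (∀ n, ℓ n ψ = 0) →
      0 ≤ σ * ((inner ℂ ψ (opMatrix ω lam γ α ψ) : ℂ).re - z * (inner ℂ ψ ψ : ℂ).re) := by
  set a := halfSymbol ω γ σ z with ha
  have hmeas : Measurable a := measurable_halfSymbol ω γ σ z
  obtain ⟨M, hM⟩ := exists_halfSymbol_le ω γ hσ z
  rw [← ha] at hM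
  have hmM : m ≤ M := (ham 0).trans (hM 0)
  set ρ : ℝ := (M - m) / (M + m) with hρ
  have hρ0 : 0 ≤ ρ := div_nonneg (by linarith) (by linarith)
  have hρ1 : ρ < 1 := (div_lt_one (by linarith)).2 (by linarith)
  have hcay : ∀ k, cayley m a k ≤ ρ := fun k => by
    have h1 := ham k
    have h2 := hM k
    rw [cayley, hρ, div_le_div_iff₀ (by linarith) (by linarith)]
    nlinarith
  obtain ⟨N, hN⟩ : ∃ N : ℕ,
      α ^ 2 * ((2 * m)⁻¹ * ((∫ q, ‖lam q‖ ^ 2) * (ρ ^ N * (2 * m)⁻¹))) < 1 := by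
    have h : Tendsto (fun N : ℕ =>
        α ^ 2 * ((2 * m)⁻¹ * ((∫ q, ‖lam q‖ ^ 2) * (ρ ^ N * (2 * m)⁻¹)))) atTop
        (𝓝 (α ^ 2 * ((2 * m)⁻¹ * ((∫ q, ‖lam q‖ ^ 2) * (0 * (2 * m)⁻¹))))) :=
      ((((tendsto_pow_atTop_nhds_zero_of_lt_one hρ0 hρ1).mul_const _).const_mul _).const_mul
        _).const_mul _
    rw [zero_mul, mul_zero, mul_zero, mul_zero] at h
    exact (h.eventually (gt_mem_nhds one_pos)).exists
  have hh : ∀ n : ℕ, MemLp (fun k => starRingEnd ℂ (lam k) *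
      ((cayley m a k ^ n * (a k + m)⁻¹ : ℝ) : ℂ)) 2 volume := by
    intro n
    refine (Lp.memLp lam).of_le_mul (c := m⁻¹) ?_ (ae_of_all _ fun k => ?_)
    · exact (Complex.continuous_conj.comp_aestronglyMeasurable (Lp.aestronglyMeasurable lam)).mul
        (Complex.measurable_ofReal.comp (((measurable_cayley hmeas).pow_const n).mul
          (hmeas.add_const m).inv)).aestronglyMeasurable
    · have h1 := ham k
      rw [norm_mul, RCLike.norm_conj, mul_comm, Complex.norm_real, Real.norm_eq_abs, abs_mul,
        abs_pow, abs_of_pos (inv_pos.2 (show 0 < a k + m by linarith))]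
      gcongr
      calc |cayley m a k| ^ n * (a k + m)⁻¹ ≤ 1 * m⁻¹ := by
            refine mul_le_mul (pow_le_one₀ (abs_nonneg _) (abs_cayley_le_one hm hm ham k))
              (inv_anti₀ hm (by linarith)) (inv_nonneg.2 (by linarith)) zero_le_one
        _ = m⁻¹ := one_mul _
  refine ⟨N + 1, fun n => ((innerSL ℂ (hh n).toLp ∘L ContinuousLinearMap.fst ℂ (L2 d) (L2sym d)) ∘L
    (WithLp.prodContinuousLinearEquiv 2 ℂ (L2 d) (L2sym d)).toContinuousLinearMap).toLinearMap,
    fun ψ hψ => ?_⟩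
  have h0 : ∀ n < N + 1,
      ∫ k, lam k * ψ.fst k * ((cayley m a k ^ n * (a k + m)⁻¹ : ℝ) : ℂ) = 0 := by
    intro n hn
    have h1 : (inner ℂ (hh n).toLp ψ.fst : ℂ) = 0 := hψ ⟨n, hn⟩
    rw [L2.inner_def] at h1
    rw [← h1]
    refine integral_congr_ae ?_
    filter_upwards [(hh n).coeFn_toLp] with k hk
    rw [hk, RCLike.inner_apply', map_mul, Complex.conj_conj, Complex.conj_ofReal]
    ring
  have hcf := cauchyForm_le_of_vanishing (Lp.memLp lam) (Lp.memLp ψ.fst) hmeas hm ham hρ0 hρ1.le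
    hcay hM N h0
  have hwi : Integrable fun k => (a k - m) * ‖ψ.fst k‖ ^ 2 :=
    (integrable_norm_sq ψ.fst).bdd_mul (c := M) (hmeas.sub_const m).aestronglyMeasurable
      (ae_of_all _ fun k => by
        rw [Real.norm_eq_abs, abs_of_nonneg (by linarith [ham k])]
        linarith [hM k])
  have hPI : ∫ k, (a k - m) * ‖ψ.fst k‖ ^ 2 ≤
      ∫ k, σ * Phi ω lam γ α (z - ω k) * ‖ψ.fst k‖ ^ 2 := by
    refine integral_mono hwi (integrable_sigma_Phi lam α hσ hm ham ψ.fst) fun k =>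
      mul_le_mul_of_nonneg_right (hPhi k) (by positivity)
  have hW : 0 ≤ ∫ k, (a k - m) * ‖ψ.fst k‖ ^ 2 :=
    integral_nonneg fun k => mul_nonneg (by linarith [ham k]) (by positivity)
  have hrem : 0 ≤ ∫ p, ‖((halfSymbol ω γ σ z p.1 + halfSymbol ω γ σ z p.2 : ℝ) : ℂ) *
      (ψ.snd : L2half d) p + σ * funC lam α ψ.fst p‖ ^ 2 *
        (halfSymbol ω γ σ z p.1 + halfSymbol ω γ σ z p.2)⁻¹ ∂(halfVol d) :=
    integral_nonneg fun p => mul_nonneg (by positivity)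
      (inv_nonneg.2 (by linarith [ham p.1, ham p.2]))
  rw [form_identity lam α hσ hm ham ψ]
  have h3 := mul_le_mul_of_nonneg_left hcf (sq_nonneg α)
  have h4 := mul_le_mul_of_nonneg_right hN.le hW
  rw [← ha] at hrem ⊢
  nlinarith

end Eigenvalues

/-- A symmetric operator whose form `σ (T - z)` is nonnegative on the common kernel of finitely many
functionals has only finitely many eigenvalues `x` with `σ x < σ z`. -/
lemma finite_eigenvalues {V : Type*} [NormedAddCommGroup V] [InnerProductSpace ℂ V]
    {T : V →ₗ[ℂ] V} (hT : T.IsSymmetric) {σ z : ℝ} {N : ℕ} (ℓ : Fin N → V →ₗ[ℂ] ℂ)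
    (h : ∀ v : V, (∀ n, ℓ n v = 0) →
      0 ≤ σ * ((inner ℂ v (T v) : ℂ).re - z * (inner ℂ v v : ℂ).re)) :
    {x : ℝ | σ * x < σ * z ∧ Module.End.HasEigenvalue T (x : ℂ)}.Finite := by
  by_contra hinf
  obtain ⟨s, hs, hcard⟩ := Set.Infinite.exists_subset_card_eq hinf (N + 1)
  have hev : ∀ x : s, ∃ v : V, T v = ((x : ℝ) : ℂ) • v ∧ v ≠ 0 := fun x => by
    obtain ⟨v, hv⟩ := (hs x.2).2.exists_hasEigenvector
    exact ⟨v, hv.apply_eq_smul, hv.2⟩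
  choose v hTv hv0 using hev
  have horth : ∀ x y : s, x ≠ y → inner ℂ (v x) (v y) = (0 : ℂ) := by
    intro x y hxy
    have h1 := hT (v x) (v y)
    rw [hTv, hTv, inner_smul_left, inner_smul_right, Complex.conj_ofReal] at h1
    have h2 : (((x : ℝ) : ℂ) - ((y : ℝ) : ℂ)) * inner ℂ (v x) (v y) = 0 := by
      rw [sub_mul, h1, sub_self]
    refine (mul_eq_zero.1 h2).resolve_left fun h3 => hxy (Subtype.ext ?_)
    exact_mod_cast sub_eq_zero.1 h3
  -- a nontrivial combination of `N + 1` eigenvectors is annihilated by the `N` functionals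
  let S : (s → ℂ) →ₗ[ℂ] V := Fintype.linearCombination ℂ v
  let L : (s → ℂ) →ₗ[ℂ] (Fin N → ℂ) := LinearMap.pi fun n => ℓ n ∘ₗ S
  have hker : LinearMap.ker L ≠ ⊥ :=
    LinearMap.ker_ne_bot_of_finrank_lt (by simp [hcard])
  obtain ⟨c, hc, hc0⟩ := Submodule.exists_mem_ne_zero_of_ne_bot hker
  have hSc : S c = ∑ x, c x • v x := Fintype.linearCombination_apply ℂ v c
  have hTS : T (S c) = ∑ x : s, (c x * ((x : ℝ) : ℂ)) • v x := by
    rw [hSc, map_sum]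
    exact Finset.sum_congr rfl fun x _ => by rw [map_smul, hTv, smul_smul]
  have hin : ∀ b : s → ℂ, inner ℂ (S c) (∑ x, b x • v x) =
      ∑ x, starRingEnd ℂ (c x) * b x * (‖v x‖ ^ 2 : ℝ) := by
    intro b
    rw [hSc, sum_inner]
    refine Finset.sum_congr rfl fun x _ => ?_
    rw [inner_sum, Finset.sum_eq_single x]
    · rw [inner_smul_left, inner_smul_right, inner_self_eq_norm_sq_to_K]
      push_cast
      simp only [Complex.coe_algebraMap]
      ring
    · intro y _ hy
      rw [inner_smul_left, inner_smul_right, horth x y hy.symm, mul_zero, mul_zero]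
    · simp
  have h1 := h (S c) fun n => congrFun (LinearMap.mem_ker.1 hc) n
  have e1 : (inner ℂ (S c) (T (S c)) : ℂ).re = ∑ x : s, (x : ℝ) * (‖c x‖ ^ 2 * ‖v x‖ ^ 2) := by
    rw [hTS, hin, Complex.re_sum]
    refine Finset.sum_congr rfl fun x _ => ?_
    rw [← mul_assoc, Complex.conj_mul']
    norm_cast
    ring
  have e2 : (inner ℂ (S c) (S c) : ℂ).re = ∑ x : s, ‖c x‖ ^ 2 * ‖v x‖ ^ 2 := by
    conv_lhs => rw [show (inner ℂ (S c) (S c) : ℂ) = inner ℂ (S c) (∑ x, c x • v x) by rw [hSc]]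
    rw [hin, Complex.re_sum]
    refine Finset.sum_congr rfl fun x _ => ?_
    rw [Complex.conj_mul']
    norm_cast
  rw [e1, e2, Finset.mul_sum, ← Finset.sum_sub_distrib, Finset.mul_sum] at h1
  obtain ⟨x₀, hx₀⟩ := Function.ne_iff.1 hc0
  refine absurd h1 (not_le.2 (Finset.sum_neg' (fun x _ => ?_) ⟨x₀, Finset.mem_univ _, ?_⟩))
  · have := (hs x.2).1
    have h3 : 0 ≤ ‖c x‖ ^ 2 * ‖v x‖ ^ 2 := by positivity
    nlinarith
  · have := (hs x₀.2).1
    have h3 : 0 < ‖c x₀‖ ^ 2 * ‖v x₀‖ ^ 2 := by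
      have := norm_pos_iff.2 hx₀
      have := norm_pos_iff.2 (hv0 x₀)
      positivity
    nlinarith

/-! ### Spectral gaps around the two-particle branch -/

section Gaps

variable {d : ℕ} {ω : X d →ᵇ ℝ} (lam : L2 d) {γ : ℝ} (α : ℝ) {σ x e : ℝ}

/-- The decrease of `Φ` in a form that covers both half-lines. -/
lemma sigma_sub_le_sigma_Phi_sub (hσ : σ ^ 2 = 1) {x y c : ℝ} (hc : 0 < c)
    (hx : ∀ k, c ≤ σ * (ω k + γ - x)) (hy : ∀ k, c ≤ σ * (ω k + γ - y)) (hxy : 0 ≤ σ * (y - x)) :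
    σ * (y - x) ≤ σ * (Phi ω lam γ α x - Phi ω lam γ α y) := by
  rcases sq_eq_one_iff.1 hσ with rfl | rfl
  · have := sub_le_Phi_sub_Phi lam α hσ hc hx hy (by linarith)
    linarith
  · have := sub_le_Phi_sub_Phi lam α hσ hc hy hx (by linarith)
    linarith

/-- Beyond the outer edge `e + x` of the two-particle branch there are only finitely many
eigenvalues; here `e` is the minimum of `ω` if `σ = 1` and its maximum if `σ = -1`. -/
lemma finite_eigenvalues_beyond (hσ : σ ^ 2 = 1) (he : ∀ k, 0 ≤ σ * (ω k - e))
    (hx : 0 < σ * (e + γ - x)) (hPhi : Phi ω lam γ α x = 0) :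
    {y : ℝ | σ * y < σ * (e + x) ∧
      Module.End.HasEigenvalue (opMatrix ω lam γ α : Module.End ℂ (H d)) (y : ℂ)}.Finite := by
  have hm : 0 < σ * (e + (γ - (e + x)) / 2) := by
    have : σ * (e + (γ - (e + x)) / 2) = σ * (e + γ - x) / 2 := by ring
    rw [this]
    exact half_pos hx
  obtain ⟨N, ℓ, hℓ⟩ := exists_functionals_form_nonneg (ω := ω) (γ := γ) (z := e + x) lam α hσ hm
    (fun k => by
      rw [halfSymbol]
      have := he k
      linarith)
    (fun k => by
      have h := sigma_sub_le_sigma_Phi_sub (ω := ω) (γ := γ) lam α hσ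
        (x := e + x - ω k) (y := x) hx (fun j => by
          have h1 := he k
          have h2 := he j
          linarith) (fun j => by
          have h2 := he j
          linarith) (by
          have h1 := he k
          linarith)
      rw [halfSymbol]
      rw [hPhi] at h
      linarith)
  exact finite_eigenvalues (V := H d) (isSymmetric_opMatrix ω lam γ α) ℓ hℓ

/-- There are no eigenvalues between the inner edge `e' + x` of the two-particle branch and the
three-particle branch. -/
lemma not_hasEigenvalue_gap (hσ : σ ^ 2 = 1) {e' z : ℝ} (he : ∀ k, 0 ≤ σ * (ω k - e))
    (he' : ∀ k, σ * (ω k - e') ≤ 0)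
    (hx : 0 < σ * (e + γ - x)) (hPhi : Phi ω lam γ α x = 0)
    (hz : σ * (e' + x) < σ * z) (hz' : σ * z < σ * (γ + 2 * e)) :
    ¬ Module.End.HasEigenvalue (opMatrix ω lam γ α : Module.End ℂ (H d)) (z : ℂ) := by
  intro hev
  obtain ⟨ψ, hψ⟩ := hev.exists_hasEigenvector
  refine hψ.2 (eq_zero_of_eigenvector (ω := ω) (γ := γ) (z := z) (m := σ * (γ + 2 * e - z) / 2)
    (δ := σ * (z - (e' + x))) lam α hσ (by linarith) (fun k => ?_) (by linarith) (fun k => ?_)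
    hψ.apply_eq_smul)
  · rw [halfSymbol]
    have := he k
    linarith
  · have h := sigma_sub_le_sigma_Phi_sub (ω := ω) (γ := γ) lam α hσ (x := x) (y := z - ω k)
      (c := min (σ * (e + γ - x)) (σ * (γ + 2 * e - z))) (lt_min hx (by linarith))
      (fun j => (min_le_left _ _).trans (by have := he j; linarith))
      (fun j => (min_le_right _ _).trans (by have := he j; have := he k; linarith))
      (by have := he' k; linarith)
    rw [hPhi] at h
    have := he' k
    linarith

end Gaps

/-! ### Approximate eigenvectors and the essential spectrum -/

lemma mem_spectrum_of_approx {V : Type*} [NormedAddCommGroup V] [NormedSpace ℂ V]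
    (T : V →L[ℂ] V) (z : ℂ) (h : ∀ ε > 0, ∃ v ≠ 0, ‖T v - z • v‖ ≤ ε * ‖v‖) :
    z ∈ spectrum ℂ T := by
  rw [spectrum.mem_iff]
  rintro ⟨u, hu⟩
  set R : V →L[ℂ] V := ↑u⁻¹ with hR
  obtain ⟨v, hv0, hv⟩ := h (2 * (‖R‖ + 1))⁻¹ (by positivity)
  have h1 : R (z • v - T v) = v := by
    have h2 : R * (algebraMap ℂ (V →L[ℂ] V) z - T) = 1 := by rw [← hu, hR, Units.inv_mul]
    have h3 := congrArg (fun S : V →L[ℂ] V => S v) h2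
    simpa [Algebra.algebraMap_eq_smul_one] using h3
  have h4 : ‖v‖ ≤ ‖R‖ * ((2 * (‖R‖ + 1))⁻¹ * ‖v‖) := by
    calc ‖v‖ = ‖R (z • v - T v)‖ := by rw [h1]
      _ ≤ ‖R‖ * ‖z • v - T v‖ := R.le_opNorm _
      _ ≤ _ := by
        rw [norm_sub_rev]
        gcongr
  have h5 := norm_pos_iff.2 hv0
  have h6 : ‖R‖ * (2 * (‖R‖ + 1))⁻¹ ≤ 1 / 2 := by
    rw [← div_eq_mul_inv, div_le_div_iff₀ (by positivity) (by norm_num)]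
    linarith
  nlinarith

section Weyl

variable {d : ℕ} (ω : X d →ᵇ ℝ) (lam : L2 d) (γ α : ℝ)

/-- Multiplication by `ω - ω k₀`. -/
noncomputable def shiftOp (k₀ : X d) : L2 d →L[ℂ] L2 d :=
  mulOp volume (ω - BoundedContinuousFunction.const (X d) (ω k₀))

lemma shiftOp_ae (k₀ : X d) (f : L2 d) :
    ∀ᵐ k, shiftOp ω k₀ f k = ((ω k - ω k₀ : ℝ) : ℂ) * f k :=
  mulOp_ae _ f

/-- Near any point `k₀` there is a nonzero function, orthogonal to a given one, on which `ω` acts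
almost as the constant `ω k₀`: combine the indicator functions of two small disjoint balls. -/
lemma exists_localized [Nontrivial (X d)] (k₀ : X d) (l : L2 d) {δ : ℝ} (hδ : 0 < δ) :
    ∃ f : L2 d, f ≠ 0 ∧ inner ℂ l f = (0 : ℂ) ∧ ‖shiftOp ω k₀ f‖ ≤ δ * ‖f‖ := by
  have hU : {k | |ω k - ω k₀| < δ} ∈ 𝓝 k₀ := by
    refine (IsOpen.mem_nhds ?_ ?_)
    · exact isOpen_lt (ω.continuous.sub continuous_const).abs continuous_const
    · simpa using hδ
  obtain ⟨r, hr, hrU⟩ := Metric.mem_nhds_iff.1 hU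
  have : (𝓝[≠] k₀).NeBot := Module.punctured_nhds_neBot ℝ (X d) k₀
  obtain ⟨k₁, hk₁, hne⟩ : ∃ k₁ ∈ Metric.ball k₀ r, k₁ ≠ k₀ := by
    obtain ⟨k₁, h1, h2⟩ := (mem_closure_iff_nhdsWithin_neBot.2 this : k₀ ∈ closure {k₀}ᶜ)
      |> fun h => mem_closure_iff_nhds.1 h _ (Metric.ball_mem_nhds k₀ hr)
    exact ⟨k₁, h1, h2⟩
  obtain ⟨V₀, V₁, hV₀, hV₁, hkV₀, hkV₁, hdis⟩ := t2_separation hne.symm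
  -- small disjoint balls around `k₀` and `k₁`, inside the region where `ω` is close to `ω k₀`
  obtain ⟨r₀, hr₀, hs₀⟩ := Metric.mem_nhds_iff.1
    (inter_mem (hV₀.mem_nhds hkV₀) (Metric.ball_mem_nhds k₀ hr))
  obtain ⟨r₁, hr₁, hs₁⟩ := Metric.mem_nhds_iff.1
    (inter_mem (hV₁.mem_nhds hkV₁) (Metric.isOpen_ball.mem_nhds hk₁))
  set e₀ : L2 d := indicatorConstLp 2 (measurableSet_ball (x := k₀) (ε := r₀))
    measure_ball_lt_top.ne (1 : ℂ) with he₀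
  set e₁ : L2 d := indicatorConstLp 2 (measurableSet_ball (x := k₁) (ε := r₁))
    measure_ball_lt_top.ne (1 : ℂ) with he₁
  have hpos : ∀ (k : X d) (s : ℝ), 0 < s → 0 < volume.real (Metric.ball k s) := fun k s hs =>
    ENNReal.toReal_pos (Metric.measure_ball_pos _ _ hs).ne' measure_ball_lt_top.ne
  have hn₀ : e₀ ≠ 0 := by
    rw [← norm_pos_iff, he₀, norm_indicatorConstLp (by norm_num) (by norm_num), norm_one, one_mul]
    exact Real.rpow_pos_of_pos (hpos _ _ hr₀) _
  have hn₁ : e₁ ≠ 0 := by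
    rw [← norm_pos_iff, he₁, norm_indicatorConstLp (by norm_num) (by norm_num), norm_one, one_mul]
    exact Real.rpow_pos_of_pos (hpos _ _ hr₁) _
  have ha₀ : ∀ᵐ k, k ∉ Metric.ball k₀ r₀ → e₀ k = 0 := indicatorConstLp_coeFn_notMem
  have ha₁ : ∀ᵐ k, k ∉ Metric.ball k₁ r₁ → e₁ k = 0 := indicatorConstLp_coeFn_notMem
  have horth : (inner ℂ e₁ e₀ : ℂ) = 0 := by
    rw [L2.inner_def]
    refine integral_eq_zero_of_ae ?_
    filter_upwards [ha₀, ha₁] with k h0 h1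
    rw [RCLike.inner_apply, Pi.zero_apply]
    by_cases hk : k ∈ Metric.ball k₀ r₀
    · rw [h1 fun hk' => Set.disjoint_left.1 hdis (hs₀ hk).1 (hs₁ hk').1, map_zero, mul_zero]
    · rw [h0 hk, zero_mul]
  have hloc : ∀ c₀ c₁ : ℂ, ‖shiftOp ω k₀ (c₀ • e₀ + c₁ • e₁)‖ ≤ δ * ‖c₀ • e₀ + c₁ • e₁‖ := by
    intro c₀ c₁
    refine Lp.norm_le_mul_norm_of_ae_le_mul ?_
    filter_upwards [ha₀, ha₁, shiftOp_ae ω k₀ (c₀ • e₀ + c₁ • e₁),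
      Lp.coeFn_add (c₀ • e₀) (c₁ • e₁), Lp.coeFn_smul c₀ e₀, Lp.coeFn_smul c₁ e₁]
      with k h0 h1 h2 h3 h4 h5
    rw [h2, norm_mul, Complex.norm_real, Real.norm_eq_abs]
    by_cases hk : k ∈ Metric.ball k₀ r
    · exact mul_le_mul_of_nonneg_right (hrU hk).le (norm_nonneg _)
    · rw [h3, Pi.add_apply, h4, h5, Pi.smul_apply, Pi.smul_apply, h0 fun h => hk (hs₀ h).2,
        h1 fun h => hk (hs₁ h).2]
      simp
  by_cases hl : (inner ℂ l e₀ : ℂ) = 0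
  · refine ⟨e₀, hn₀, hl, ?_⟩
    have := hloc 1 0
    simpa using this
  · refine ⟨(-(inner ℂ l e₁ / inner ℂ l e₀) : ℂ) • e₀ + (1 : ℂ) • e₁, fun h => hn₁ ?_, ?_, hloc _ _⟩
    · have h1 : (inner ℂ e₁
          ((-(inner ℂ l e₁ / inner ℂ l e₀) : ℂ) • e₀ + (1 : ℂ) • e₁) : ℂ) = 0 := by
        rw [h, inner_zero_right]
      rw [inner_add_right, inner_smul_right, horth, mul_zero, zero_add, one_smul] at h1
      exact inner_self_eq_zero.1 h1
    · rw [inner_add_right, inner_smul_right, inner_smul_right]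
      field_simp
      ring

variable {ω γ}

/-- If `conj l` is the boson part of the eigenfunction of the one-boson model at `x`, then
the second row of `𝒜 - (ω k₀ + x)`, applied to `f` and the symmetrized product of `conj l` and `f`,
gives that product with `f` replaced by `(ω - ω k₀) f`. -/
lemma opD_opC_two_particle {l : L2 d} {x : ℝ} (k₀ : X d)
    (hl : ∀ᵐ k, l k * ((ω k + γ - x : ℝ) : ℂ) = -(α * lam k)) (f : L2 d) :
    opC lam α f + opD ω γ (opC l 1 f) - ((ω k₀ + x : ℝ) : ℂ) • opC l 1 f =
      opC l 1 (shiftOp ω k₀ f) := by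
  refine Subtype.ext (Lp.ext ?_)
  have h1 := shiftOp_ae ω k₀ f
  filter_upwards [opC_ae lam α f, opD_ae ω γ (opC l 1 f), opC_ae l 1 f,
    opC_ae l 1 (shiftOp ω k₀ f), (qmp_fst d).ae hl, (qmp_snd d).ae hl, (qmp_fst d).ae h1,
    (qmp_snd d).ae h1,
    Lp.coeFn_sub ((opC lam α f : L2half d) + (opD ω γ (opC l 1 f) : L2half d))
      (((ω k₀ + x : ℝ) : ℂ) • (opC l 1 f : L2half d)),
    Lp.coeFn_add (opC lam α f : L2half d) (opD ω γ (opC l 1 f) : L2half d),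
    Lp.coeFn_smul ((ω k₀ + x : ℝ) : ℂ) (opC l 1 f : L2half d)]
    with p e1 e2 e3 e4 e5 e6 e7 e8 e9 e10 e11
  refine Eq.trans e9 ?_
  rw [Pi.sub_apply, e10, Pi.add_apply, e11, Pi.smul_apply, e1, e2, e3, e4, funC, funC, funC, e7, e8,
    smul_eq_mul]
  have e5' := congrArg (starRingEnd ℂ) e5
  have e6' := congrArg (starRingEnd ℂ) e6
  simp only [map_mul, map_neg, Complex.conj_ofReal] at e5' e6'
  push_cast at e5' e6' ⊢
  linear_combination f p.2 * e5' + f p.1 * e6'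

lemma opD_opC_three_particle (k₀ : X d) (f : L2 d) :
    opD ω γ (opC (star f) 1 f) - ((γ + 2 * ω k₀ : ℝ) : ℂ) • opC (star f) 1 f =
      (2 : ℂ) • opC (star f) 1 (shiftOp ω k₀ f) := by
  refine Subtype.ext (Lp.ext ?_)
  have h1 := shiftOp_ae ω k₀ f
  have h2 := Lp.coeFn_star f
  filter_upwards [opD_ae ω γ (opC (star f) 1 f), opC_ae (star f) 1 f,
    opC_ae (star f) 1 (shiftOp ω k₀ f), (qmp_fst d).ae h2, (qmp_snd d).ae h2, (qmp_fst d).ae h1,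
    (qmp_snd d).ae h1,
    Lp.coeFn_sub (opD ω γ (opC (star f) 1 f) : L2half d)
      (((γ + 2 * ω k₀ : ℝ) : ℂ) • (opC (star f) 1 f : L2half d)),
    Lp.coeFn_smul ((γ + 2 * ω k₀ : ℝ) : ℂ) (opC (star f) 1 f : L2half d),
    Lp.coeFn_smul (2 : ℂ) (opC (star f) 1 (shiftOp ω k₀ f) : L2half d)]
    with p e1 e2 e3 e4 e5 e6 e7 e8 e9 e10
  refine Eq.trans e8 (Eq.trans ?_ e10.symm)
  rw [Pi.sub_apply, e9, Pi.smul_apply, Pi.smul_apply, e1, e2, e3, funC, funC, e4, e5, e6, e7,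
    smul_eq_mul, smul_eq_mul, Pi.star_apply, Pi.star_apply]
  simp only [RCLike.star_def, Complex.conj_conj]
  push_cast
  ring

lemma norm_star_Lp (f : L2 d) : ‖star f‖ = ‖f‖ := by
  rw [Lp.norm_def, Lp.norm_def, eLpNorm_congr_norm_ae (g := f)]
  filter_upwards [Lp.coeFn_star f] with k hk
  rw [hk, Pi.star_apply, norm_star]

lemma norm_sq_toLp (f : L2 d) (g : L2sym d) : ‖(WithLp.toLp 2 (f, g) : H d)‖ ^ 2 =
    ‖f‖ ^ 2 + ‖g‖ ^ 2 :=
  WithLp.prod_norm_sq_eq_of_L2 _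

/-- The three-particle branch: approximate eigenvectors `f ⊗ f` with `f` localized near `k₀`. -/
lemma three_particle_mem_spectrum [Nontrivial (X d)] (k₀ : X d) :
    ((γ + 2 * ω k₀ : ℝ) : ℂ) ∈ spectrum ℂ (opMatrix ω lam γ α) := by
  refine mem_spectrum_of_approx _ _ fun ε hε => ?_
  obtain ⟨f, hf0, hlf, hf⟩ := exists_localized ω k₀ (star lam) (δ := ε / 4) (by positivity)
  have hfl : (inner ℂ (star f) lam : ℂ) = 0 := by
    rw [← hlf, ← integral_mul_eq_inner, ← integral_mul_eq_inner]
    simp only [mul_comm]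
  set ψ : H d := WithLp.toLp 2 (0, opC (star f) 1 f) with hψ
  have hres : opMatrix ω lam γ α ψ - ((γ + 2 * ω k₀ : ℝ) : ℂ) • ψ =
      WithLp.toLp 2 (0, (2 : ℂ) • opC (star f) 1 (shiftOp ω k₀ f)) := by
    refine WithLp.ofLp_injective 2 (Prod.ext ?_ ?_)
    · change opA ω γ (0 : L2 d) + opB lam α (opC (star f) 1 f) -
        ((γ + 2 * ω k₀ : ℝ) : ℂ) • (0 : L2 d) = 0
      rw [map_zero, opB_opC, hlf, hfl]
      simp
    · change opC lam α (0 : L2 d) + opD ω γ (opC (star f) 1 f) -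
        ((γ + 2 * ω k₀ : ℝ) : ℂ) • opC (star f) 1 f = _
      rw [map_zero, zero_add, opD_opC_three_particle]
  have hfpos := norm_pos_iff.2 hf0
  have hψn : ‖f‖ ^ 2 ≤ ‖ψ‖ := by
    refine le_of_sq_le_sq ?_ (norm_nonneg _)
    rw [hψ, norm_sq_toLp, norm_opC_star_self, norm_zero]
    nlinarith [pow_pos hfpos 4]
  refine ⟨ψ, fun h => ?_, ?_⟩
  · rw [h, norm_zero] at hψn
    nlinarith [pow_pos hfpos 2]
  · rw [hres]
    have h1 : ‖(WithLp.toLp 2 ((0 : L2 d), (2 : ℂ) • opC (star f) 1 (shiftOp ω k₀ f)) : H d)‖ =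
        2 * ‖opC (star f) 1 (shiftOp ω k₀ f)‖ := by
      refine (sq_eq_sq₀ (norm_nonneg _) (by positivity)).1 ?_
      have h2 : ‖(2 : ℂ) • opC (star f) 1 (shiftOp ω k₀ f)‖ =
          2 * ‖opC (star f) 1 (shiftOp ω k₀ f)‖ := by
        rw [norm_smul]
        norm_num
      rw [norm_sq_toLp, norm_zero, h2]
      ring
    rw [h1]
    have h3 := norm_opC_le (star f) 1 (shiftOp ω k₀ f)
    rw [norm_star_Lp, abs_one] at h3
    calc 2 * ‖opC (star f) 1 (shiftOp ω k₀ f)‖ ≤ 2 * (2 * 1 * ‖f‖ * (ε / 4 * ‖f‖)) := by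
          refine mul_le_mul_of_nonneg_left (h3.trans ?_) zero_le_two
          gcongr
      _ = ε * ‖f‖ ^ 2 := by ring
      _ ≤ ε * ‖ψ‖ := by gcongr

/-- The two-particle branch: `f` localized near `k₀` is paired with the eigenfunction of the
one-boson model for the zero `x` of `Φ`. -/
lemma two_particle_mem_spectrum [Nontrivial (X d)] {σ c x : ℝ} (hσ : σ ^ 2 = 1) (hc : 0 < c)
    (hx : ∀ k, c ≤ σ * (ω k + γ - x)) (hPhi : Phi ω lam γ α x = 0) (k₀ : X d) :
    ((ω k₀ + x : ℝ) : ℂ) ∈ spectrum ℂ (opMatrix ω lam γ α) := by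
  have hne : ∀ k, ω k + γ - x ≠ 0 := fun k h => by
    have := hx k
    rw [h, mul_zero] at this
    linarith
  have hlmem : MemLp (fun k => -(α * lam k) * (((ω k + γ - x)⁻¹ : ℝ) : ℂ)) 2 volume := by
    refine (Lp.memLp lam).of_le_mul (c := |α| * c⁻¹) ?_ (ae_of_all _ fun k => ?_)
    · exact (((Lp.aestronglyMeasurable lam).const_mul _).neg).mul
        (Complex.measurable_ofReal.comp
          ((ω.continuous.measurable.add_const γ).sub_const x).inv).aestronglyMeasurable
    · rw [norm_mul, norm_neg, norm_mul, Complex.norm_real, Complex.norm_real, norm_inv,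
        Real.norm_eq_abs, Real.norm_eq_abs, mul_right_comm]
      have h : c ≤ |ω k + γ - x| := by
        refine (hx k).trans ((le_abs_self _).trans ?_)
        rw [abs_mul, abs_eq_one_of_sq hσ, one_mul]
      gcongr
  set l : L2 d := hlmem.toLp with hl
  have hlae : ∀ᵐ k, l k * ((ω k + γ - x : ℝ) : ℂ) = -(α * lam k) := by
    filter_upwards [hlmem.coeFn_toLp] with k hk
    have := hne k
    rw [hl, hk, mul_assoc, ← Complex.ofReal_mul, inv_mul_cancel₀ this, Complex.ofReal_one, mul_one]
  have hllam : (inner ℂ l lam : ℂ) = ((-(α * ∫ q, ‖lam q‖ ^ 2 / (ω q + γ - x)) : ℝ) : ℂ) := by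
    rw [L2.inner_def, ← integral_const_mul, ← integral_neg, ← integral_complex_ofReal]
    refine integral_congr_ae ?_
    filter_upwards [hlmem.coeFn_toLp] with k hk
    rw [hl, hk, RCLike.inner_apply', map_mul, map_neg, map_mul, Complex.conj_ofReal,
      Complex.conj_ofReal]
    have := Complex.conj_mul' (lam k)
    push_cast
    rw [div_eq_mul_inv, ← this]
    ring
  refine mem_spectrum_of_approx _ _ fun ε hε => ?_
  obtain ⟨f, hf0, hlf, hf⟩ := exists_localized ω k₀ (star lam) (δ := ε / (1 + 2 * ‖l‖))
    (by positivity)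
  set h : L2 d := shiftOp ω k₀ f with hh
  set ψ : H d := WithLp.toLp 2 (f, opC l 1 f) with hψ
  have hres : opMatrix ω lam γ α ψ - ((ω k₀ + x : ℝ) : ℂ) • ψ = WithLp.toLp 2 (h, opC l 1 h) := by
    refine WithLp.ofLp_injective 2 (Prod.ext ?_ ?_)
    · change opA ω γ f + opB lam α (opC l 1 f) - ((ω k₀ + x : ℝ) : ℂ) • f = h
      rw [opB_opC, hlf, zero_smul, zero_add, smul_smul, hllam, ← Complex.ofReal_mul]
      have hcoef : α * 1 * -(α * ∫ q, ‖lam q‖ ^ 2 / (ω q + γ - x)) = γ + x := by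
        rw [Phi] at hPhi
        linarith
      rw [hcoef]
      refine Lp.ext ?_
      filter_upwards [opA_ae ω γ f, shiftOp_ae ω k₀ f,
        Lp.coeFn_sub (opA ω γ f + ((γ + x : ℝ) : ℂ) • f) (((ω k₀ + x : ℝ) : ℂ) • f),
        Lp.coeFn_add (opA ω γ f) (((γ + x : ℝ) : ℂ) • f), Lp.coeFn_smul ((γ + x : ℝ) : ℂ) f,
        Lp.coeFn_smul ((ω k₀ + x : ℝ) : ℂ) f] with k e1 e2 e3 e4 e5 e6
      rw [e3, Pi.sub_apply, e4, Pi.add_apply, e5, e6, Pi.smul_apply, Pi.smul_apply, e1, hh, e2,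
        smul_eq_mul, smul_eq_mul]
      push_cast
      ring
    · exact opD_opC_two_particle lam α k₀ hlae f
  have hψn : ‖f‖ ≤ ‖ψ‖ := WithLp.norm_fst_le (L2 d) ψ
  have hfpos := norm_pos_iff.2 hf0
  refine ⟨ψ, fun h0 => ?_, ?_⟩
  · rw [h0, norm_zero] at hψn
    linarith
  · rw [hres]
    have h1 : ‖(WithLp.toLp 2 (h, opC l 1 h) : H d)‖ ≤ ‖h‖ + ‖opC l 1 h‖ := by
      refine le_of_sq_le_sq ?_ (by positivity)
      rw [norm_sq_toLp]
      nlinarith [norm_nonneg h, norm_nonneg (opC l 1 h)]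
    have h2 := norm_opC_le l 1 h
    rw [abs_one, mul_one] at h2
    calc _ ≤ ‖h‖ + ‖opC l 1 h‖ := h1
      _ ≤ (1 + 2 * ‖l‖) * ‖h‖ := by linarith
      _ ≤ (1 + 2 * ‖l‖) * (ε / (1 + 2 * ‖l‖) * ‖f‖) := by gcongr
      _ = ε * ‖f‖ := by field_simp
      _ ≤ ε * ‖ψ‖ := by gcongr

end Weyl

/-! ### Accumulation points of the discrete spectrum -/

section Accumulation

variable {V : Type*} [NormedAddCommGroup V] [InnerProductSpace ℂ V] {T : V →L[ℂ] V}

/-- Spectral values inside an interval contained in the spectrum are not isolated. -/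
lemma notMem_discreteSpectrum_of_Ioo {a b x : ℝ}
    (h : ∀ y ∈ Ioo a b, (y : ℂ) ∈ spectrum ℂ T) (hx : x ∈ Ioo a b) :
    (x : ℂ) ∉ discreteSpectrum T := by
  rintro ⟨-, hacc, -⟩
  refine hacc (accPt_iff_nhds.2 fun U hU => ?_)
  have hU' : Complex.ofReal ⁻¹' U ∩ Ioo a b ∈ 𝓝 x :=
    inter_mem (Complex.continuous_ofReal.continuousAt hU) (isOpen_Ioo.mem_nhds hx)
  obtain ⟨y, ⟨hyU, hyI⟩, hyx⟩ := (𝓝[≠] x).nonempty_of_mem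
    (inter_mem (mem_nhdsWithin_of_mem_nhds hU') self_mem_nhdsWithin)
  exact ⟨y, ⟨hyU, h y hyI⟩, fun e => hyx (by exact_mod_cast e)⟩

/-- For a symmetric operator it suffices to look along the real line on either side of `z`. -/
lemma not_accPt_discreteSpectrum (hT : (T : V →ₗ[ℂ] V).IsSymmetric) {a b z : ℝ} (ha : a < z)
    (hb : z < b) (hleft : {x : ℝ | x ∈ Ioo a z ∧ (x : ℂ) ∈ discreteSpectrum T}.Finite)
    (hright : {x : ℝ | x ∈ Ioo z b ∧ (x : ℂ) ∈ discreteSpectrum T}.Finite) :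
    ¬ AccPt (z : ℂ) (𝓟 (discreteSpectrum T)) := by
  intro hacc
  set S : Set ℝ := {x : ℝ | x ∈ Ioo a z ∧ (x : ℂ) ∈ discreteSpectrum T} ∪
    {x : ℝ | x ∈ Ioo z b ∧ (x : ℂ) ∈ discreteSpectrum T} with hS
  have hSfin : (Complex.ofReal '' S).Finite := (hleft.union hright).image _
  have hzS : (z : ℂ) ∉ Complex.ofReal '' S := by
    rintro ⟨x, hx, hxz⟩
    rw [Complex.ofReal_inj] at hxz
    subst hxz
    rcases hx with hx | hx
    · exact lt_irrefl _ hx.1.2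
    · exact lt_irrefl _ hx.1.1
  have hI : Complex.re ⁻¹' Ioo a b ∈ 𝓝 (z : ℂ) :=
    Complex.continuous_re.continuousAt (isOpen_Ioo.mem_nhds ⟨ha, hb⟩)
  obtain ⟨w, ⟨⟨hwI, hwS⟩, hwd⟩, hwz⟩ := accPt_iff_nhds.1 hacc _
    (inter_mem hI (hSfin.isClosed.isOpen_compl.mem_nhds hzS))
  -- eigenvalues of a symmetric operator are real
  have hre : ((w.re : ℝ) : ℂ) = w :=
    Complex.conj_eq_iff_re.1 (hT.conj_eigenvalue_eq_self hwd.2.2.1)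
  have hne : w.re ≠ z := fun e => hwz (by rw [← hre, e])
  refine hwS ⟨w.re, ?_, hre⟩
  rcases hne.lt_or_gt with h | h
  · exact Or.inl ⟨⟨hwI.1, h⟩, hre.symm ▸ hwd⟩
  · exact Or.inr ⟨⟨h, hwI.2⟩, hre.symm ▸ hwd⟩

end Accumulation

section Edges

variable {d : ℕ} {ω : X d →ᵇ ℝ} (lam : L2 d) {γ : ℝ} (α : ℝ)

lemma omegaInf_le (k : X d) : omegaInf ω ≤ ω k :=
  ciInf_le ⟨-‖ω‖, by rintro _ ⟨k, rfl⟩; exact (abs_le.1 (ω.norm_coe_le_norm k)).1⟩ k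

lemma le_omegaSup (k : X d) : ω k ≤ omegaSup ω :=
  le_ciSup (f := fun k => ω k)
    ⟨‖ω‖, by rintro _ ⟨k, rfl⟩; exact (abs_le.1 (ω.norm_coe_le_norm k)).2⟩ k

lemma exists_eq_of_mem_Ioo {v : ℝ} (hv : v ∈ Ioo (omegaInf ω) (omegaSup ω)) : ∃ k, ω k = v := by
  obtain ⟨k₀, h₀⟩ := exists_lt_of_ciInf_lt hv.1
  obtain ⟨k₁, h₁⟩ := exists_lt_of_lt_ciSup hv.2
  exact mem_range_of_exists_le_of_exists_ge ω.continuous ⟨k₀, h₀.le⟩ ⟨k₁, h₁.le⟩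

/-- Inside the two-particle branch the discrete spectrum is finite, being empty. -/
lemma finite_discreteSpectrum_two_particle [Nontrivial (X d)] {σ c x a b : ℝ} (hσ : σ ^ 2 = 1)
    (hc : 0 < c) (hx : ∀ k, c ≤ σ * (ω k + γ - x)) (hPhi : Phi ω lam γ α x = 0)
    (ha : omegaInf ω + x ≤ a) (hb : b ≤ omegaSup ω + x) :
    {y : ℝ | y ∈ Ioo a b ∧ (y : ℂ) ∈ discreteSpectrum (opMatrix (d := d) ω lam γ α)}.Finite := by
  refine Set.finite_empty.subset fun y hy =>
    notMem_discreteSpectrum_of_Ioo (V := H d) (fun t ht => ?_) hy.1 hy.2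
  obtain ⟨k, hk⟩ := exists_eq_of_mem_Ioo (ω := ω) (v := t - x)
    ⟨by linarith [ht.1], by linarith [ht.2]⟩
  have := two_particle_mem_spectrum lam α hσ hc hx hPhi k
  rwa [hk, sub_add_cancel] at this

/-- Inside the three-particle branch the discrete spectrum is finite, being empty. -/
lemma finite_discreteSpectrum_three_particle [Nontrivial (X d)] {a b : ℝ}
    (ha : γ + 2 * omegaInf ω ≤ a) (hb : b ≤ γ + 2 * omegaSup ω) :
    {y : ℝ | y ∈ Ioo a b ∧ (y : ℂ) ∈ discreteSpectrum (opMatrix (d := d) ω lam γ α)}.Finite := by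
  refine Set.finite_empty.subset fun y hy =>
    notMem_discreteSpectrum_of_Ioo (V := H d) (fun t ht => ?_) hy.1 hy.2
  obtain ⟨k, hk⟩ := exists_eq_of_mem_Ioo (ω := ω) (v := (t - γ) / 2)
    ⟨by linarith [ht.1], by linarith [ht.2]⟩
  have := three_particle_mem_spectrum (ω := ω) (γ := γ) lam α k
  rwa [hk, mul_div_cancel₀ _ two_ne_zero, add_sub_cancel] at this

end Edges

end SpinBoson

theorem theorem2p3 (d : ℕ) (ω : SpinBoson.X d →ᵇ ℝ) (hω_nonneg : ∀ k, 0 ≤ ω k)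
    (hω_nonconst : ∃ k₁ k₂, ω k₁ ≠ ω k₂) (lam : SpinBoson.L2 d) (hlam : lam ≠ 0)
    (γ α : ℝ) (hα : 0 < α) :
    (∀ E : ℝ, E < SpinBoson.omegaInf ω + γ → SpinBoson.Phi ω lam γ α E = 0 →
      ¬ AccPt ((SpinBoson.omegaInf ω + E : ℝ) : ℂ)
          (𝓟 (SpinBoson.discreteSpectrum (SpinBoson.opMatrix (d := d) ω lam γ α))) ∧
      ¬ AccPt ((SpinBoson.omegaSup ω + E : ℝ) : ℂ)
          (𝓟 (SpinBoson.discreteSpectrum (SpinBoson.opMatrix (d := d) ω lam γ α)))) ∧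
    (∀ F : ℝ, SpinBoson.omegaSup ω + γ < F → SpinBoson.Phi ω lam γ α F = 0 →
      ¬ AccPt ((SpinBoson.omegaInf ω + F : ℝ) : ℂ)
          (𝓟 (SpinBoson.discreteSpectrum (SpinBoson.opMatrix (d := d) ω lam γ α))) ∧
      ¬ AccPt ((SpinBoson.omegaSup ω + F : ℝ) : ℂ)
          (𝓟 (SpinBoson.discreteSpectrum (SpinBoson.opMatrix (d := d) ω lam γ α)))) := by
  obtain ⟨k₁, k₂, hk⟩ := hω_nonconst
  have : Nontrivial (SpinBoson.X d) := ⟨k₁, k₂, fun h => hk (by rw [h])⟩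
  have hinf := SpinBoson.omegaInf_le (ω := ω)
  have hsup := SpinBoson.le_omegaSup (ω := ω)
  have hlt : SpinBoson.omegaInf ω < SpinBoson.omegaSup ω := by
    rcases hk.lt_or_gt with h | h
    · exact (hinf k₁).trans_lt (h.trans_le (hsup k₂))
    · exact (hinf k₂).trans_lt (h.trans_le (hsup k₁))
  have hsym := SpinBoson.isSymmetric_opMatrix ω lam γ α
  have hone : (1 : ℝ) ^ 2 = 1 := one_pow 2
  have hneg : (-1 : ℝ) ^ 2 = 1 := by norm_num
  refine ⟨fun E hE hPhi => ?_, fun F hF hPhi => ?_⟩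
  · have hc : 0 < SpinBoson.omegaInf ω + γ - E := by linarith
    have hx : ∀ k, SpinBoson.omegaInf ω + γ - E ≤ 1 * (ω k + γ - E) := fun k => by
      linarith [hinf k]
    refine ⟨SpinBoson.not_accPt_discreteSpectrum (V := SpinBoson.H d) hsym
      (a := SpinBoson.omegaInf ω + E - 1) (b := SpinBoson.omegaSup ω + E) (by linarith)
      (by linarith) ?_
      (SpinBoson.finite_discreteSpectrum_two_particle lam α hone hc hx hPhi le_rfl le_rfl), ?_⟩
    · refine (SpinBoson.finite_eigenvalues_beyond lam α hone (e := SpinBoson.omegaInf ω)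
        (fun k => by linarith [hinf k]) (by linarith) hPhi).subset fun y hy => ⟨?_, hy.2.2.2.1⟩
      have := hy.1.2
      linarith
    · rcases lt_or_ge (SpinBoson.omegaSup ω + E) (γ + 2 * SpinBoson.omegaInf ω) with hgap | hover
      · refine SpinBoson.not_accPt_discreteSpectrum (V := SpinBoson.H d) hsym
          (a := SpinBoson.omegaInf ω + E) (b := γ + 2 * SpinBoson.omegaInf ω) (by linarith) hgap
          (SpinBoson.finite_discreteSpectrum_two_particle lam α hone hc hx hPhi le_rfl le_rfl) ?_
        refine Set.finite_empty.subset fun y hy =>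
          SpinBoson.not_hasEigenvalue_gap lam α hone (e := SpinBoson.omegaInf ω)
            (e' := SpinBoson.omegaSup ω) (fun k => by linarith [hinf k])
            (fun k => by linarith [hsup k]) (by linarith) hPhi (by linarith [hy.1.1])
            (by linarith [hy.1.2]) hy.2.2.2.1
      · exact SpinBoson.not_accPt_discreteSpectrum (V := SpinBoson.H d) hsym
          (a := SpinBoson.omegaInf ω + E) (b := γ + 2 * SpinBoson.omegaSup ω) (by linarith)
          (by linarith)
          (SpinBoson.finite_discreteSpectrum_two_particle lam α hone hc hx hPhi le_rfl le_rfl)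
          (SpinBoson.finite_discreteSpectrum_three_particle lam α hover le_rfl)
  · have hc : 0 < F - SpinBoson.omegaSup ω - γ := by linarith
    have hx : ∀ k, F - SpinBoson.omegaSup ω - γ ≤ -1 * (ω k + γ - F) := fun k => by
      linarith [hsup k]
    refine ⟨?_, SpinBoson.not_accPt_discreteSpectrum (V := SpinBoson.H d) hsym
      (a := SpinBoson.omegaInf ω + F) (b := SpinBoson.omegaSup ω + F + 1) (by linarith)
      (by linarith)
      (SpinBoson.finite_discreteSpectrum_two_particle lam α hneg hc hx hPhi le_rfl le_rfl) ?_⟩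
    · rcases lt_or_ge (γ + 2 * SpinBoson.omegaSup ω) (SpinBoson.omegaInf ω + F) with hgap | hover
      · refine SpinBoson.not_accPt_discreteSpectrum (V := SpinBoson.H d) hsym
          (a := γ + 2 * SpinBoson.omegaSup ω) (b := SpinBoson.omegaSup ω + F) hgap (by linarith) ?_
          (SpinBoson.finite_discreteSpectrum_two_particle lam α hneg hc hx hPhi le_rfl le_rfl)
        refine Set.finite_empty.subset fun y hy =>
          SpinBoson.not_hasEigenvalue_gap lam α hneg (e := SpinBoson.omegaSup ω)
            (e' := SpinBoson.omegaInf ω) (fun k => by linarith [hsup k])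
            (fun k => by linarith [hinf k]) (by linarith) hPhi (by linarith [hy.1.2])
            (by linarith [hy.1.1]) hy.2.2.2.1
      · exact SpinBoson.not_accPt_discreteSpectrum (V := SpinBoson.H d) hsym
          (a := γ + 2 * SpinBoson.omegaInf ω) (b := SpinBoson.omegaSup ω + F) (by linarith)
          (by linarith)
          (SpinBoson.finite_discreteSpectrum_three_particle lam α le_rfl hover)
          (SpinBoson.finite_discreteSpectrum_two_particle lam α hneg hc hx hPhi le_rfl le_rfl)
    · refine (SpinBoson.finite_eigenvalues_beyond lam α hneg (e := SpinBoson.omegaSup ω)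
        (fun k => by linarith [hsup k]) (by linarith) hPhi).subset fun y hy => ⟨?_, hy.2.2.2.1⟩
      have := hy.1.1
      linarith
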